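/- Let $k$ be a field, $H$ a finite-dimensional Hopf algebra over $k$ with comultiplication $\Delta$, counit $\varepsilon$ and antipode $S$, and $R\subseteq H$ a Hopf subalgebra (a unital subalgebra with $\Delta(R)\subseteq R\otimes R$ and $S(R)\subseteq R$). Put $R^+=R\cap\ker\varepsilon$ and let $V=H/R^+H$, a right $H$-module and, by restriction, a right $R$-module. *Similarity.* For modules $M,N$ over a ring write $M\mid qN$ if $M$ is isomorphic to a direct summand of the direct sum of $q$ copies of $N$; $M\sim N$ means $M\mid qN$ and $N\mid rM$ for some $q,r\in\mathbb N$. *Subalgebra depth.* For a subalgebra $B\subseteq A$ let $A^{\otimes_B n}=A\otimes_B\cdots\otimes_B A$ ($n$ factors, $n\ge 1$) and $A^{\otimes_B 0}=B$. The subalgebra $B\subseteq A$ has depth $2n+1$ ($n\ge 0$) if $A^{\otimes_B(n+1)}\sim A^{\otimes_B n}$ as $B$-$B$-bimodules; depth $2n$ ($n\ge 1$) if $A^{\otimes_B(n+1)}\sim A^{\otimes_B n}$ as $B$-$A$-bimodules or as $A$-$B$-bimodules; h-depth $2n-1$ ($n\ge 1$) if $A^{\otimes_B(n+1)}\sim A^{\otimes_B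 n}$ as $A$-$A$-bimodules. Let $d(B,A)$ and $d_h(B,A)$ be the least depth and the least h-depth ($\infty$ if there is none), and let $d_{\mathrm{even}}(B,A)=2\lceil d(B,A)/2\rceil$ be the least even number $\ge d(B,A)$ ($\infty$ if $d(B,A)=\infty$). *Module depth.* For $L\in\{R,H\}$ let $\mathcal M_L$ be the tensor category of finite-dimensional right $L$-modules, with $(u\otimes w)h=\sum uh_{(1)}\otimes wh_{(2)}$ and unit object $k_\varepsilon$. For $W\in\mathcal M_L$ nonzero put $T_0(W)=k_\varepsilon$ and $T_n(W)=W\oplus W^{\otimes 2}\oplus\cdots\oplus W^{\otimes n}$ for $n\ge1$. Then $W$ has depth $n\ge 0$ in $\mathcal M_L$ if $T_{n+1}(W)\mid q\,T_n(W)$ for some $q\in\mathbb N$; $d(W,\mathcal M_L)$ is the least such $n$ ($\infty$ if there is none). **Theorem.** In $\mathbb N\cup\{\infty\}$, $$d_{\mathrm{even}}(R,H)=2\,d(V,\mathcal M_R)+2,\qquad d_h(R,H)=2\,d(V,\mathcal M_H)+1,$$ and consequently $$2\,d(V,\mathcal M_R)+1\ \le\ d(R,H)\ \le\ 2\,d(V,\mathcal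 M_R)+2 .$$ -/

import Mathlib

open scoped TensorProduct
open MulOpposite

universe u

noncomputable section

namespace HopfDepth

/-! ### Similarity of modules -/

section Similarity

variable (E : Type*) [Ring E] (M N : Type*) [AddCommGroup M] [Module E M]
  [AddCommGroup N] [Module E N]

/-- `M` divides a multiple of `N`: `M` is isomorphic to a direct summand of a finite direct sum
`N ⊕ ⋯ ⊕ N` of `q` copies of `N`. -/
def DividesMultiple : Prop :=
  ∃ (q : ℕ) (P Q : Submodule E (Fin q → N)), IsCompl P Q ∧ Nonempty (M ≃ₗ[E] P)

/-- Similarity of modules: each divides a multiple of the other. -/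
def Similar : Prop :=
  DividesMultiple E M N ∧ DividesMultiple E N M

end Similarity

/-! ### Bimodules over `k`-algebras -/

section Bimodules

variable (k : Type u) [Field k]

/-- An `X`-`Y`-bimodule over the field `k`: a `k`-vector space with a left action of `X` and a
right action of `Y` (a left action of `Yᵐᵒᵖ`) that commute; `k` acts centrally. -/
structure Bimodule (X Y : Type u) [Ring X] [Algebra k X] [Ring Y] [Algebra k Y] where
  carrier : Type u
  [addCommGroup : AddCommGroup carrier]
  [module : Module k carrier]
  left : X →ₐ[k] Module.End k carrier
  right : Yᵐᵒᵖ →ₐ[k] Module.End k carrier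
  comm : ∀ x y, Commute (left x) (right y)

attribute [instance] Bimodule.addCommGroup Bimodule.module

variable {k}

/-- The algebra map `E → End (M ⧸ P)` induced by `f : E → End M` on the quotient by an
invariant subspace `P`. -/
def quotientAction {E M : Type*} [Ring E] [Algebra k E] [AddCommGroup M] [Module k M]
    (f : E →ₐ[k] Module.End k M) (P : Submodule k M) (h : ∀ e, P ≤ P.comap (f e)) :
    E →ₐ[k] Module.End k (M ⧸ P) :=
  AlgHom.ofLinearMap
    { toFun := fun e => P.mapQ P (f e) (h e)
      map_add' := fun a b => by
        apply Submodule.linearMap_qext; ext m; simp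
      map_smul' := fun c a => by
        apply Submodule.linearMap_qext; ext m; simp }
    (by apply Submodule.linearMap_qext; ext m; simp)
    (fun a b => by apply Submodule.linearMap_qext; ext m; simp)

namespace Bimodule

variable {X Y B : Type u} [Ring X] [Algebra k X] [Ring Y] [Algebra k Y]
  [Ring B] [Algebra k B]

/-- `X`-`Y`-bimodules are modules over `X ⊗ Yᵐᵒᵖ`, with `(x ⊗ y) m = x m y`. -/
instance (M : Bimodule k X Y) : Module (X ⊗[k] Yᵐᵒᵖ) M.carrier :=
  Module.compHom M.carrier (Algebra.TensorProduct.lift M.left M.right M.comm).toRingHom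

variable (k) in
/-- The regular bimodule `X` over itself. -/
def regular (X : Type u) [Ring X] [Algebra k X] : Bimodule k X X where
  carrier := X
  left := Algebra.lsmul k k X
  right := Algebra.lsmul k k X
  comm _ _ := by ext m; simp [mul_assoc]

/-- Restriction of a bimodule along algebra maps on both sides. -/
def restrict {X' Y' : Type u} [Ring X'] [Algebra k X'] [Ring Y'] [Algebra k Y']
    (M : Bimodule k X Y) (f : X' →ₐ[k] X) (g : Y' →ₐ[k] Y) : Bimodule k X' Y' where
  carrier := M.carrier
  left := M.left.comp f
  right := M.right.comp (AlgHom.op g)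
  comm _ _ := M.comm _ _

/-- The subspace of `M ⊗ N` spanned by all `m b ⊗ n - m ⊗ b n`. -/
def balancing (M : Bimodule k X B) (N : Bimodule k B Y) :
    Submodule k (M.carrier ⊗[k] N.carrier) :=
  Submodule.span k {t | ∃ (m : M.carrier) (b : B) (n : N.carrier),
    t = M.right (op b) m ⊗ₜ[k] n - m ⊗ₜ[k] N.left b n}

/-- The tensor product `M ⊗_B N` over the (not necessarily commutative) algebra `B`,
an `X`-`Y`-bimodule by `x (m ⊗ n) y = x m ⊗ n y`. -/
def tensor (M : Bimodule k X B) (N : Bimodule k B Y) : Bimodule k X Y where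
  carrier := (M.carrier ⊗[k] N.carrier) ⧸ balancing M N
  left := quotientAction ((Module.End.rTensorAlgHom k M.carrier N.carrier).comp M.left)
    (balancing M N) (fun x => by
      refine Submodule.span_le.2 ?_
      rintro _ ⟨m, b, n, rfl⟩
      refine Submodule.subset_span ⟨M.left x m, b, n, ?_⟩
      have h : M.left x (M.right (op b) m) = M.right (op b) (M.left x m) :=
        LinearMap.congr_fun (M.comm x (op b)) m
      refine (map_sub _ _ _).trans ?_
      change M.left x (M.right (op b) m) ⊗ₜ[k] n - M.left x m ⊗ₜ[k] N.left b n = _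
      rw [h])
  right := quotientAction ((Module.End.lTensorAlgHom k N.carrier M.carrier).comp N.right)
    (balancing M N) (fun y => by
      refine Submodule.span_le.2 ?_
      rintro _ ⟨m, b, n, rfl⟩
      refine Submodule.subset_span ⟨m, b, N.right y n, ?_⟩
      have h : N.left b (N.right y n) = N.right y (N.left b n) :=
        LinearMap.congr_fun (N.comm b y) n
      refine (map_sub _ _ _).trans ?_
      change M.right (op b) m ⊗ₜ[k] N.right y n - m ⊗ₜ[k] N.right y (N.left b n) = _
      rw [h])
  comm x y := by
    apply Submodule.linearMap_qext
    apply TensorProduct.ext'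
    intro m n
    rfl

end Bimodule

end Bimodules

/-! ### Depth and h-depth of a subalgebra -/

section SubalgebraDepth

variable {k : Type u} [Field k] {A : Type u} [Ring A] [Algebra k A] (B : Subalgebra k A)

/-- `tensorPower B n` is the `A`-`A`-bimodule `A ⊗_B ⋯ ⊗_B A` with `n + 1` factors `A`. -/
def tensorPower : ℕ → Bimodule k A A
  | 0 => Bimodule.regular k A
  | n + 1 => ((tensorPower n).restrict (AlgHom.id k A) B.val).tensor
      ((Bimodule.regular k A).restrict B.val (AlgHom.id k A))

/-- The `n`-th tensor power of `A` over `B` as a `B`-`B`-bimodule, the zeroth one being `B`. -/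
def tensorPowerBB : ℕ → Bimodule k B B
  | 0 => Bimodule.regular k B
  | n + 1 => (tensorPower B n).restrict B.val B.val

/-- Depth `2 n + 1` for `n ≥ 0`: the tensor powers of `A` over `B` with `n + 1` and `n` factors
are similar as `B`-`B`-bimodules. -/
def HasOddDepth (n : ℕ) : Prop :=
  Similar (B ⊗[k] Bᵐᵒᵖ) (tensorPowerBB B (n + 1)).carrier (tensorPowerBB B n).carrier

/-- Left depth `2 (n + 1)`: the tensor powers of `A` over `B` with `n + 2` and `n + 1` factors
are similar as `B`-`A`-bimodules. -/
def HasLeftDepth (n : ℕ) : Prop :=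
  Similar (B ⊗[k] Aᵐᵒᵖ) ((tensorPower B (n + 1)).restrict B.val (AlgHom.id k A)).carrier
    ((tensorPower B n).restrict B.val (AlgHom.id k A)).carrier

/-- Right depth `2 (n + 1)`: the tensor powers of `A` over `B` with `n + 2` and `n + 1` factors
are similar as `A`-`B`-bimodules. -/
def HasRightDepth (n : ℕ) : Prop :=
  Similar (A ⊗[k] Bᵐᵒᵖ) ((tensorPower B (n + 1)).restrict (AlgHom.id k A) B.val).carrier
    ((tensorPower B n).restrict (AlgHom.id k A) B.val).carrier

/-- The subalgebra `B ⊆ A` has depth `d ≥ 1`. Even depth means left or right even depth. -/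
def HasDepth (d : ℕ) : Prop :=
  (∃ n, d = 2 * n + 1 ∧ HasOddDepth B n) ∨
    (∃ n, d = 2 * (n + 1) ∧ (HasLeftDepth B n ∨ HasRightDepth B n))

/-- The subalgebra `B ⊆ A` has h-depth `d = 2 (n + 1) - 1 = 2 n + 1`: the tensor powers of `A`
over `B` with `n + 2` and `n + 1` factors are similar as `A`-`A`-bimodules. -/
def HasHDepth (d : ℕ) : Prop :=
  ∃ n, d = 2 * n + 1 ∧
    Similar (A ⊗[k] Aᵐᵒᵖ) (tensorPower B (n + 1)).carrier (tensorPower B n).carrier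

/-- The minimum depth `d(B, A)`, equal to `⊤` if there is no finite depth. -/
def minDepth : ℕ∞ := ⨅ (d : ℕ) (_ : HasDepth B d), (d : ℕ∞)

/-- The minimum h-depth `d_h(B, A)`, equal to `⊤` if there is no finite h-depth. -/
def minHDepth : ℕ∞ := ⨅ (d : ℕ) (_ : HasHDepth B d), (d : ℕ∞)

/-- The least even number greater than or equal to `d(B, A)`; it is `⊤` iff `d(B, A) = ⊤`. -/
def minEvenDepth : ℕ∞ := sInf {m : ℕ∞ | Even m ∧ minDepth B ≤ m}

end SubalgebraDepth

/-! ### Right modules over a bialgebra, their tensor products and depth -/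

section ModuleDepth

variable (k : Type u) [Field k]

/-- A right module over the `k`-algebra `H`, i.e. a left module over `Hᵐᵒᵖ`. -/
structure RightModule (H : Type u) [Ring H] [Algebra k H] where
  carrier : Type u
  [addCommGroup : AddCommGroup carrier]
  [module : Module k carrier]
  act : Hᵐᵒᵖ →ₐ[k] Module.End k carrier

attribute [instance] RightModule.addCommGroup RightModule.module

namespace RightModule

variable {k}

section Algebra

variable {H : Type u} [Ring H] [Algebra k H]

instance (W : RightModule k H) : Module Hᵐᵒᵖ W.carrier :=
  Module.compHom W.carrier W.act.toRingHom

instance (W : RightModule k H) : IsScalarTower k Hᵐᵒᵖ W.carrier :=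
  ⟨fun c h w => by
    change W.act (c • h) w = c • W.act h w
    simp⟩

variable (k H) in
/-- Bundling of a right module. -/
def of (W : Type u) [AddCommGroup W] [Module k W] [Module Hᵐᵒᵖ W] [IsScalarTower k Hᵐᵒᵖ W] :
    RightModule k H where
  carrier := W
  act := Algebra.lsmul k k W

/-- Restriction of a right module along an algebra map. -/
def restrict {H' : Type u} [Ring H'] [Algebra k H'] (W : RightModule k H) (f : H' →ₐ[k] H) :
    RightModule k H' where
  carrier := W.carrier
  act := W.act.comp (AlgHom.op f)

end Algebra

variable {H : Type u} [Ring H] [Bialgebra k H]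

variable (k H) in
/-- The unit module: `k` with `H` acting through the counit. -/
def unit : RightModule k H where
  carrier := k
  act := (Algebra.ofId k (Module.End k k)).comp
    (AlgHom.fromOpposite (Bialgebra.counitAlgHom k H) fun _ _ => Commute.all _ _)

/-- The tensor product of right `H`-modules with the diagonal action
`(u ⊗ w) h = ∑ u h₍₁₎ ⊗ w h₍₂₎`. -/
def tensor (U W : RightModule k H) : RightModule k H where
  carrier := U.carrier ⊗[k] W.carrier
  act := ((Module.endTensorEndAlgHom (R := k) (S := k) (A := k)).comp
    (Algebra.TensorProduct.map U.act W.act)).comp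
      ((Algebra.TensorProduct.opAlgEquiv k k H H).symm.toAlgHom.comp
        (AlgHom.op (Bialgebra.comulAlgHom k H)))

/-- The tensor powers of `W`; the zeroth one is the unit module. -/
def tpow (W : RightModule k H) : ℕ → RightModule k H
  | 0 => unit k H
  | n + 1 => (W.tpow n).tensor W

/-- The truncated tensor algebra: the direct sum of the tensor powers of `W` of degrees
`1, …, n` if `n ≥ 1`, and the unit module if `n = 0`. -/
def truncated (W : RightModule k H) : ℕ → RightModule k H
  | 0 => unit k H
  | n + 1 => of k H (∀ i : Fin (n + 1), (W.tpow (i + 1)).carrier)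

/-- `W` has depth `n` in the tensor category of right `H`-modules. -/
def HasModuleDepth (W : RightModule k H) (n : ℕ) : Prop :=
  DividesMultiple Hᵐᵒᵖ (W.truncated (n + 1)).carrier (W.truncated n).carrier

/-- The minimum depth of `W` in the tensor category of right `H`-modules, equal to `⊤` if `W`
has no finite depth. -/
def depth (W : RightModule k H) : ℕ∞ := ⨅ (n : ℕ) (_ : W.HasModuleDepth n), (n : ℕ∞)

end RightModule

end ModuleDepth

/-! ### Hopf subalgebras -/

section HopfSubalgebras

variable (k : Type u) [Field k] (H : Type u) [Ring H] [HopfAlgebra k H]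

/-- A Hopf subalgebra: a unital subalgebra `R` with `Δ(R) ⊆ R ⊗ R` and `S(R) ⊆ R`. -/
structure HopfSubalgebra extends Subalgebra k H where
  comul_mem : ∀ r ∈ toSubalgebra, Coalgebra.comul (R := k) r ∈
    (Algebra.TensorProduct.map toSubalgebra.val toSubalgebra.val).range
  antipode_mem : ∀ r ∈ toSubalgebra, HopfAlgebra.antipode k r ∈ toSubalgebra

namespace HopfSubalgebra

variable {k H} (R : HopfSubalgebra k H)

/-- The canonical map `R ⊗ R → H ⊗ H`. -/
def incl₂ : R.toSubalgebra ⊗[k] R.toSubalgebra →ₐ[k] H ⊗[k] H :=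
  Algebra.TensorProduct.map R.toSubalgebra.val R.toSubalgebra.val

lemma incl₂_tmul (x y : R.toSubalgebra) : R.incl₂ (x ⊗ₜ[k] y) = (x : H) ⊗ₜ[k] (y : H) := rfl

lemma incl₂_injective : Function.Injective R.incl₂ :=
  TensorProduct.map_injective_of_flat_flat _ _ Subtype.val_injective Subtype.val_injective

/-- The comultiplication of `H` restricted to `R → R ⊗ R`. -/
def comulHom : R.toSubalgebra →ₐ[k] R.toSubalgebra ⊗[k] R.toSubalgebra :=
  (AlgEquiv.ofInjective R.incl₂ R.incl₂_injective).symm.toAlgHom.comp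
    (((Bialgebra.comulAlgHom k H).comp R.toSubalgebra.val).codRestrict R.incl₂.range
      fun r => R.comul_mem r r.2)

lemma incl₂_comulHom (r : R.toSubalgebra) :
    R.incl₂ (R.comulHom r) = Coalgebra.comul (R := k) (r : H) :=
  congrArg Subtype.val ((AlgEquiv.ofInjective R.incl₂ R.incl₂_injective).apply_symm_apply
    ⟨Coalgebra.comul (R := k) (r : H), R.comul_mem r r.2⟩)

/-- `R` is a bialgebra with the structure restricted from `H`. -/
instance : Bialgebra k R.toSubalgebra :=
  Bialgebra.ofAlgHom R.comulHom ((Bialgebra.counitAlgHom k H).comp R.toSubalgebra.val)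
    (by
      ext r
      have hinj : Function.Injective
          (Algebra.TensorProduct.map R.toSubalgebra.val R.incl₂) :=
        TensorProduct.map_injective_of_flat_flat _ _ Subtype.val_injective R.incl₂_injective
      apply hinj
      have h₁ (t : R.toSubalgebra ⊗[k] R.toSubalgebra) :
          Algebra.TensorProduct.map R.toSubalgebra.val R.incl₂
            (Algebra.TensorProduct.assoc k k k _ _ _
              (Algebra.TensorProduct.map R.comulHom (.id k _) t)) =
          TensorProduct.assoc k H H H (Coalgebra.comul.rTensor H (R.incl₂ t)) := by
        induction t with
        | zero => simp
        | add x y hx hy => simp only [map_add, hx, hy]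
        | tmul x y =>
          have h (s : R.toSubalgebra ⊗[k] R.toSubalgebra) :
              Algebra.TensorProduct.map R.toSubalgebra.val R.incl₂
                (Algebra.TensorProduct.assoc k k k _ _ _ (s ⊗ₜ[k] y)) =
              TensorProduct.assoc k H H H (R.incl₂ s ⊗ₜ[k] (y : H)) := by
            induction s with
            | zero => simp
            | add a b ha hb => simp only [map_add, TensorProduct.add_tmul, ha, hb]
            | tmul a b => simp [incl₂_tmul]
          simpa [incl₂_comulHom, incl₂_tmul] using h (R.comulHom x)
      have h₂ (t : R.toSubalgebra ⊗[k] R.toSubalgebra) :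
          Algebra.TensorProduct.map R.toSubalgebra.val R.incl₂
            (Algebra.TensorProduct.map (.id k _) R.comulHom t) =
          Coalgebra.comul.lTensor H (R.incl₂ t) := by
        induction t with
        | zero => simp
        | add x y hx hy => simp only [map_add, hx, hy]
        | tmul x y => simp [incl₂_comulHom, incl₂_tmul]
      refine (h₁ _).trans (Eq.trans ?_ (h₂ _).symm)
      erw [incl₂_comulHom]
      exact Coalgebra.coassoc_apply (R := k) (r : H))
    (by
      ext r
      have hinj : Function.Injective
          (Algebra.TensorProduct.map (.id k k) R.toSubalgebra.val) :=
        TensorProduct.map_injective_of_flat_flat _ _ Function.injective_id Subtype.val_injective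
      apply hinj
      have h (t : R.toSubalgebra ⊗[k] R.toSubalgebra) :
          Algebra.TensorProduct.map (.id k k) R.toSubalgebra.val (Algebra.TensorProduct.map
            ((Bialgebra.counitAlgHom k H).comp R.toSubalgebra.val) (.id k _) t) =
          Coalgebra.counit.rTensor H (R.incl₂ t) := by
        induction t with
        | zero => simp
        | add x y hx hy => simp only [map_add, hx, hy]
        | tmul x y => simp [incl₂_tmul]
      refine (h _).trans ?_
      erw [incl₂_comulHom, Coalgebra.rTensor_counit_comul]
      simp)
    (by
      ext r
      have hinj : Function.Injective
          (Algebra.TensorProduct.map R.toSubalgebra.val (.id k k)) :=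
        TensorProduct.map_injective_of_flat_flat _ _ Subtype.val_injective Function.injective_id
      apply hinj
      have h (t : R.toSubalgebra ⊗[k] R.toSubalgebra) :
          Algebra.TensorProduct.map R.toSubalgebra.val (.id k k) (Algebra.TensorProduct.map
            (.id k _) ((Bialgebra.counitAlgHom k H).comp R.toSubalgebra.val) t) =
          Coalgebra.counit.lTensor H (R.incl₂ t) := by
        induction t with
        | zero => simp
        | add x y hx hy => simp only [map_add, hx, hy]
        | tmul x y => simp [incl₂_tmul]
      refine (h _).trans ?_
      erw [incl₂_comulHom, Coalgebra.lTensor_counit_comul]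
      simp)

/-- The right ideal `R⁺H` of `H` generated by `R⁺ = R ∩ ker ε`. -/
def augIdeal : Submodule Hᵐᵒᵖ H :=
  Submodule.span Hᵐᵒᵖ {r : H | r ∈ R.toSubalgebra ∧ Coalgebra.counit (R := k) r = 0}

/-- The generalized permutation module `V = H / R⁺H`, a right `H`-module. -/
def permModule : RightModule k H := RightModule.of k H (H ⧸ R.augIdeal)

end HopfSubalgebra

end HopfSubalgebras

end HopfDepth

end

/-!
Write `V = H / R⁺H`. The Galois map `u ⊗ h ↦ ∑ u h₍₁₎ ⊗ h₍₂₎` induces `U ⊗_R H ≅ U ⊗ V` for every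
right `H`-module `U`, so by iteration the tensor power `H ⊗_R ⋯ ⊗_R H` with `n + 1` factors is
`H ⊗ V^{⊗ n}`, with left action on `H` and diagonal right action. Killing the left action of
`ker ε` on `H ⊗ W` gives back `W`; hence h-depth `2 n + 1`, respectively right depth `2 n + 2`,
means that `V^{⊗ (n + 1)}` and `V^{⊗ n}` are similar over `H`, respectively over `R`. Moreover `V`
is a quotient coalgebra of `H`, so `V` divides `V ⊗ V`, each `T_n(V)` is similar to `V^{⊗ n}`, and
this similarity is module depth `n`.

The other depth conditions imply the same similarity over `R`. For left depth `2 n + 2`, take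
coinvariants of the right `H`-action instead: they identify `H ⊗ U` with `U` by
`h ⊗ u ↦ u S⁻¹(h)`, which turns the left action of `S(r)` into the right action of `r`. For depth
`2 n + 1`, kill the left action of `R⁺`, which turns `H ⊗ V^{⊗ n}` into `V^{⊗ (n + 1)}`.
-/

noncomputable section

namespace HopfDepth

/-! ### Similarity by families of homomorphisms -/

section Similarity

variable {E : Type*} [Ring E] {M N P : Type*} [AddCommGroup M] [Module E M]
  [AddCommGroup N] [Module E N] [AddCommGroup P] [Module E P]

lemma dividesMultiple_of_leftInverse {q : ℕ} (f : M →ₗ[E] (Fin q → N))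
    (g : (Fin q → N) →ₗ[E] M) (h : Function.LeftInverse g f) : DividesMultiple E M N := by
  have hgf : g ∘ₗ f = .id := LinearMap.ext h
  have isIdempotentElem : IsIdempotentElem (f ∘ₗ g) := by
    rw [IsIdempotentElem, Module.End.mul_eq_comp, LinearMap.comp_assoc, ← LinearMap.comp_assoc g,
      hgf, LinearMap.id_comp]
  have isCompl := LinearMap.IsIdempotentElem.isCompl isIdempotentElem
  rw [LinearMap.range_comp_of_range_eq_top _ (LinearMap.range_eq_top.2 h.surjective),
    LinearMap.ker_comp_of_ker_eq_bot _ (LinearMap.ker_eq_bot.2 h.injective)] at isCompl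
  exact ⟨q, _, _, isCompl, ⟨LinearEquiv.ofInjective f h.injective⟩⟩

lemma DividesMultiple.of_sum_apply_eq {ι : Type*} [Fintype ι] (f : ι → M →ₗ[E] N)
    (g : ι → N →ₗ[E] M) (h : ∀ m, ∑ i, g i (f i m) = m) : DividesMultiple E M N := by
  let e := Fintype.equivFin ι
  refine dividesMultiple_of_leftInverse (.pi fun j => f (e.symm j))
    (LinearMap.lsum E _ ℕ fun j => g (e.symm j)) fun m => ?_
  simpa using (e.symm.sum_comp fun i => g i (f i m)).trans (h m)

lemma DividesMultiple.exists_sum_apply_eq (h : DividesMultiple E M N) :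
    ∃ (q : ℕ) (f : Fin q → M →ₗ[E] N) (g : Fin q → N →ₗ[E] M), ∀ m, ∑ i, g i (f i m) = m := by
  obtain ⟨q, A, B, hAB, ⟨e⟩⟩ := h
  let g : (Fin q → N) →ₗ[E] M := e.symm.toLinearMap ∘ₗ A.projectionOnto B hAB
  refine ⟨q, fun i => .proj i ∘ₗ A.subtype ∘ₗ e.toLinearMap,
    fun i => g ∘ₗ .single E (fun _ => N) i, fun m => ?_⟩
  have : ∑ i, g (Pi.single i ((e m : Fin q → N) i)) = g (e m) := by
    rw [← map_sum, Finset.univ_sum_single]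
  exact this.trans (by simp [g])

lemma DividesMultiple.of_leftInverse (f : M →ₗ[E] N) (g : N →ₗ[E] M)
    (h : Function.LeftInverse g f) : DividesMultiple E M N :=
  .of_sum_apply_eq (ι := Unit) (fun _ => f) (fun _ => g) (by simpa using fun m => h m)

lemma DividesMultiple.of_equiv (e : M ≃ₗ[E] N) : DividesMultiple E M N :=
  .of_leftInverse e.toLinearMap e.symm.toLinearMap e.symm_apply_apply

lemma DividesMultiple.refl : DividesMultiple E M M := .of_equiv (.refl E M)

lemma DividesMultiple.trans (h₁ : DividesMultiple E M N) (h₂ : DividesMultiple E N P) :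
    DividesMultiple E M P := by
  obtain ⟨q, f, g, h⟩ := h₁.exists_sum_apply_eq
  obtain ⟨q', f', g', h'⟩ := h₂.exists_sum_apply_eq
  refine .of_sum_apply_eq (ι := Fin q × Fin q') (fun i => f' i.2 ∘ₗ f i.1)
    (fun i => g i.1 ∘ₗ g' i.2) fun m => ?_
  simp only [LinearMap.comp_apply, Fintype.sum_prod_type, ← map_sum, h', h]

lemma DividesMultiple.pi {ι : Type*} [Finite ι] {M : ι → Type*}
    [∀ i, AddCommGroup (M i)] [∀ i, Module E (M i)] (h : ∀ i, DividesMultiple E (M i) N) :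
    DividesMultiple E (∀ i, M i) N := by
  classical
  cases nonempty_fintype ι
  choose q f g hfg using fun i => (h i).exists_sum_apply_eq
  refine .of_sum_apply_eq (ι := Σ i, Fin (q i)) (fun i => f i.1 i.2 ∘ₗ .proj i.1)
    (fun i => .single E M i.1 ∘ₗ g i.1 i.2) fun m => ?_
  have sum_single (i : ι) : ∑ j, LinearMap.single E M i (g i j (f i j (m i))) =
      Pi.single i (m i) := by rw [← map_sum, hfg, LinearMap.single_apply]
  simp only [LinearMap.comp_apply, Fintype.sum_sigma, LinearMap.proj_apply, sum_single]
  exact Finset.univ_sum_single m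

lemma dividesMultiple_pi {ι : Type*} {M : ι → Type*} [∀ i, AddCommGroup (M i)]
    [∀ i, Module E (M i)] (i : ι) : DividesMultiple E (M i) (∀ i, M i) := by
  classical
  exact .of_leftInverse (.single E M i) (.proj i) fun m => Pi.single_eq_same i m

/-- `F` and `G` stand for the action of an additive functor on homomorphisms; only the stated
consequence of additivity and functoriality matters. -/
lemma DividesMultiple.map {E' : Type*} [Ring E'] {M' N' : Type*} [AddCommGroup M'] [Module E' M']
    [AddCommGroup N'] [Module E' N'] (F : (M →ₗ[E] N) → M' →ₗ[E'] N')
    (G : (N →ₗ[E] M) → N' →ₗ[E'] M')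
    (hFG : ∀ (q : ℕ) (f : Fin q → M →ₗ[E] N) (g : Fin q → N →ₗ[E] M),
      (∀ m, ∑ i, g i (f i m) = m) → ∀ m, ∑ i, G (g i) (F (f i) m) = m)
    (h : DividesMultiple E M N) : DividesMultiple E' M' N' := by
  obtain ⟨q, f, g, hfg⟩ := h.exists_sum_apply_eq
  exact .of_sum_apply_eq (fun i => F (f i)) (fun i => G (g i)) (hFG q f g hfg)

lemma Similar.trans (h₁ : Similar E M N) (h₂ : Similar E N P) : Similar E M P :=
  ⟨h₁.1.trans h₂.1, h₂.2.trans h₁.2⟩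

lemma Similar.of_equiv (e : M ≃ₗ[E] N) : Similar E M N := ⟨.of_equiv e, .of_equiv e.symm⟩

lemma similar_congr {M' N' : Type*} [AddCommGroup M'] [Module E M'] [AddCommGroup N']
    [Module E N'] (e : M ≃ₗ[E] M') (e' : N ≃ₗ[E] N') : Similar E M N ↔ Similar E M' N' :=
  ⟨fun h => ((Similar.of_equiv e.symm).trans h).trans (.of_equiv e'),
    fun h => ((Similar.of_equiv e).trans h).trans (.of_equiv e'.symm)⟩

end Similarity

/-! ### Linear maps commuting with actions -/

section Intertwines

variable {k E E' L M N : Type*} [CommRing k] [Ring E] [Algebra k E] [Ring E'] [Algebra k E']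
  [AddCommGroup L] [Module k L] [AddCommGroup M] [Module k M] [AddCommGroup N] [Module k N]
  {ρ : E →ₐ[k] Module.End k L} {σ : E →ₐ[k] Module.End k M} {τ : E →ₐ[k] Module.End k N}

/-- The linear map `f` commutes with the actions `ρ` and `σ` of `E`. Bimodules and right modules
carry their actions as algebra maps, so this expresses `E`-linearity separately for each of
them. -/
def Intertwines (ρ : E →ₐ[k] Module.End k L) (σ : E →ₐ[k] Module.End k M) (f : L →ₗ[k] M) : Prop :=
  ∀ e, f ∘ₗ ρ e = σ e ∘ₗ f

lemma Intertwines.apply {f : L →ₗ[k] M} (hf : Intertwines ρ σ f) (e : E) (x : L) :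
    f (ρ e x) = σ e (f x) :=
  LinearMap.congr_fun (hf e) x

lemma Intertwines.comp {f : L →ₗ[k] M} {g : M →ₗ[k] N} (hg : Intertwines σ τ g)
    (hf : Intertwines ρ σ f) : Intertwines ρ τ (g ∘ₗ f) := fun e => by
  rw [LinearMap.comp_assoc, hf, ← LinearMap.comp_assoc, hg, LinearMap.comp_assoc]

lemma Intertwines.symm {f : L ≃ₗ[k] M} (hf : Intertwines ρ σ f.toLinearMap) :
    Intertwines σ ρ f.symm.toLinearMap := fun e => by
  rw [LinearEquiv.toLinearMap_symm_comp_eq, ← LinearMap.comp_assoc, hf, LinearMap.comp_assoc,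
    LinearEquiv.comp_symm, LinearMap.comp_id]

lemma Intertwines.restrict {f : L →ₗ[k] M} (hf : Intertwines ρ σ f) (g : E' →ₐ[k] E) :
    Intertwines (ρ.comp g) (σ.comp g) f :=
  fun e => hf (g e)

end Intertwines

lemma sum_lTensor_apply_eq {k U M N : Type*} [CommRing k] [AddCommGroup U] [Module k U]
    [AddCommGroup M] [Module k M] [AddCommGroup N] [Module k N] {ι : Type*} [Fintype ι]
    {f : ι → M →ₗ[k] N} {g : ι → N →ₗ[k] M} (h : ∀ m, ∑ i, g i (f i m) = m) (t : U ⊗[k] M) :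
    ∑ i, (g i).lTensor U ((f i).lTensor U t) = t := by
  induction t with
  | zero => simp
  | tmul u m => simp only [LinearMap.lTensor_tmul, ← TensorProduct.tmul_sum, h]
  | add s t hs ht => simp only [map_add, Finset.sum_add_distrib, hs, ht]

lemma ker_rTensor_eq_span {k N W : Type*} [CommRing k] [AddCommGroup N] [Module k N]
    [AddCommGroup W] [Module k W] {π : N →ₗ[k] W} (hπ : Function.Surjective π) {s : Set N}
    (hs : LinearMap.ker π = .span k s) (U : Type*) [AddCommGroup U] [Module k U] :
    LinearMap.ker (π.rTensor U) = .span k (Set.image2 (· ⊗ₜ[k] ·) s .univ) := by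
  rw [(rTensor_exact U π.exact_subtype_ker_map hπ).linearMap_ker_eq, LinearMap.rTensor,
    TensorProduct.range_map, Submodule.range_subtype, hs, LinearMap.range_id,
    ← Submodule.span_univ, Submodule.map₂_span_span]
  rfl

lemma ker_lTensor_eq_span {k N W : Type*} [CommRing k] [AddCommGroup N] [Module k N]
    [AddCommGroup W] [Module k W] {π : N →ₗ[k] W} (hπ : Function.Surjective π) {s : Set N}
    (hs : LinearMap.ker π = .span k s) (U : Type*) [AddCommGroup U] [Module k U] :
    LinearMap.ker (π.lTensor U) = .span k (Set.image2 (· ⊗ₜ[k] ·) .univ s) := by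
  rw [(lTensor_exact U π.exact_subtype_ker_map hπ).linearMap_ker_eq, LinearMap.lTensor,
    TensorProduct.range_map, Submodule.range_subtype, hs, LinearMap.range_id,
    ← Submodule.span_univ, Submodule.map₂_span_span]
  rfl

section Coalgebra

open Coalgebra
open scoped Coalgebra

variable {k C L M N : Type*} [CommRing k] [AddCommGroup C] [Module k C] [Coalgebra k C]
  [AddCommGroup L] [Module k L] [AddCommGroup M] [Module k M] [AddCommGroup N] [Module k N]

lemma rid_comp_map_comp_comul (f : C →ₗ[k] M) (c : k) :
    (TensorProduct.rid k M).toLinearMap ∘ₗ TensorProduct.map f (c • counit) ∘ₗ comul = c • f := by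
  rw [TensorProduct.map_smul_right]
  ext x
  simp [← LinearMap.rTensor_comp_lTensor]

lemma lid_comp_map_comp_comul (f : C →ₗ[k] M) (c : k) :
    (TensorProduct.lid k M).toLinearMap ∘ₗ TensorProduct.map (c • counit) f ∘ₗ comul = c • f := by
  rw [TensorProduct.map_smul_left]
  ext x
  simp [← LinearMap.lTensor_comp_rTensor]

lemma assoc_comp_map_comp_comul (f : C →ₗ[k] L) (g : C →ₗ[k] M) (h : C →ₗ[k] N) :
    (TensorProduct.assoc k L M N).toLinearMap ∘ₗ
        TensorProduct.map (TensorProduct.map f g ∘ₗ comul) h ∘ₗ comul =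
      TensorProduct.map f (TensorProduct.map g h ∘ₗ comul) ∘ₗ comul := by
  calc
    _ = (TensorProduct.assoc k L M N ∘ₗ TensorProduct.map (TensorProduct.map f g) h) ∘ₗ
        comul.rTensor C ∘ₗ comul := by
      rw [← LinearMap.map_comp_rTensor, LinearMap.comp_assoc, LinearMap.comp_assoc]
    _ = TensorProduct.map f (TensorProduct.map g h) ∘ₗ comul.lTensor C ∘ₗ comul := by
      rw [← TensorProduct.map_map_comp_assoc_eq, LinearMap.comp_assoc, coassoc]
    _ = _ := by rw [← LinearMap.comp_assoc, LinearMap.map_comp_lTensor]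

lemma map_counit_smulRight_comp_comul (m : M) (g : C →ₗ[k] N) :
    TensorProduct.map (counit.smulRight m) g ∘ₗ comul = TensorProduct.mk k M N m ∘ₗ g := by
  calc
    _ = TensorProduct.map (LinearMap.toSpanSingleton k M m) g ∘ₗ counit.rTensor C ∘ₗ comul := by
      rw [← LinearMap.comp_assoc, LinearMap.map_comp_rTensor]
      rfl
    _ = _ := LinearMap.ext fun c => by simp

lemma map_smulRight_counit_comp_comul (f : C →ₗ[k] M) (n : N) :
    TensorProduct.map f (counit.smulRight n) ∘ₗ comul = (TensorProduct.mk k M N).flip n ∘ₗ f := by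
  calc
    _ = TensorProduct.map f (LinearMap.toSpanSingleton k N n) ∘ₗ counit.lTensor C ∘ₗ comul := by
      rw [← LinearMap.comp_assoc, LinearMap.map_comp_lTensor]
      rfl
    _ = _ := LinearMap.ext fun c => by simp

lemma map_comp_comul_comp {D F : Type*} [AddCommGroup D] [Module k D] [Coalgebra k D]
    [FunLike F D C] [CoalgHomClass F k D C]
    (f : C →ₗ[k] M) (g : C →ₗ[k] N) (φ : F) :
    (TensorProduct.map f g ∘ₗ comul) ∘ₗ (φ : D →ₗ[k] C) =
      TensorProduct.map (f ∘ₗ (φ : D →ₗ[k] C)) (g ∘ₗ (φ : D →ₗ[k] C)) ∘ₗ comul := by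
  rw [LinearMap.comp_assoc, ← CoalgHomClass.map_comp_comul φ, ← LinearMap.comp_assoc,
    ← TensorProduct.map_comp]

end Coalgebra

namespace RightModule

variable {k : Type u} [Field k]

section Algebra

variable {H : Type u} [Ring H] [Algebra k H] {U V W : RightModule k H}

/-- The orbit maps `h ↦ w h`. -/
def orbit (W : RightModule k H) : W.carrier →ₗ[k] H →ₗ[k] W.carrier :=
  (W.act.toLinearMap ∘ₗ (opLinearEquiv k).toLinearMap).flip

lemma intertwines_iff {f : U.carrier →ₗ[k] W.carrier} :
    Intertwines U.act W.act f ↔ U.orbit.compr₂ f = W.orbit ∘ₗ f :=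
  ⟨fun hf => LinearMap.ext fun u => LinearMap.ext fun h => hf.apply (op h) u,
    fun hf e => LinearMap.ext fun u => LinearMap.congr_fun (LinearMap.congr_fun hf u) e.unop⟩

/-- A linear map commuting with the right actions, as a homomorphism of modules. -/
def homOfIntertwines (f : U.carrier →ₗ[k] W.carrier) (hf : Intertwines U.act W.act f) :
    U.carrier →ₗ[Hᵐᵒᵖ] W.carrier :=
  { f with map_smul' := hf.apply }

lemma intertwines_restrictScalars (f : U.carrier →ₗ[Hᵐᵒᵖ] W.carrier) :
    Intertwines U.act W.act (f.restrictScalars k) :=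
  fun e => LinearMap.ext (f.map_smul e)

end Algebra

section Bialgebra

variable {H : Type u} [Ring H] [Bialgebra k H] {U V W U' W' : RightModule k H}

open Coalgebra

lemma orbit_unit (c : k) : (unit k H).orbit c = c • counit :=
  LinearMap.ext fun h => mul_comm (counit (R := k) h) c

lemma orbit_tmul (u : U.carrier) (w : W.carrier) :
    (U.tensor W).orbit (u ⊗ₜ[k] w) = TensorProduct.map (U.orbit u) (W.orbit w) ∘ₗ comul := by
  have (s : H ⊗[k] H) : Module.endTensorEndAlgHom (R := k) (S := k) (A := k)
      (Algebra.TensorProduct.map U.act W.act ((Algebra.TensorProduct.opAlgEquiv k k H H).symm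
        (op s))) (u ⊗ₜ[k] w) = TensorProduct.map (U.orbit u) (W.orbit w) s := by
    induction s with
    | zero => simp
    | tmul g h => rfl
    | add s t hs ht => rw [op_add, map_add, map_add, map_add, LinearMap.add_apply, hs, ht, map_add]
  exact LinearMap.ext fun h => this (comul h)

lemma intertwines_rTensor {f : U.carrier →ₗ[k] U'.carrier} (hf : Intertwines U.act U'.act f)
    (W : RightModule k H) :
    Intertwines (U.tensor W).act (U'.tensor W).act (f.rTensor W.carrier) := by
  refine intertwines_iff.2 (TensorProduct.ext' fun u w => ?_)
  have hu : f ∘ₗ U.orbit u = U'.orbit (f u) := LinearMap.congr_fun (intertwines_iff.1 hf) u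
  change f.rTensor W.carrier ∘ₗ (U.tensor W).orbit (u ⊗ₜ w) = (U'.tensor W).orbit (f u ⊗ₜ w)
  rw [orbit_tmul, orbit_tmul, ← LinearMap.comp_assoc, LinearMap.rTensor_comp_map, hu]

lemma intertwines_lTensor {f : W.carrier →ₗ[k] W'.carrier} (hf : Intertwines W.act W'.act f)
    (U : RightModule k H) :
    Intertwines (U.tensor W).act (U.tensor W').act (f.lTensor U.carrier) := by
  refine intertwines_iff.2 (TensorProduct.ext' fun u w => ?_)
  have hw : f ∘ₗ W.orbit w = W'.orbit (f w) := LinearMap.congr_fun (intertwines_iff.1 hf) w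
  change f.lTensor U.carrier ∘ₗ (U.tensor W).orbit (u ⊗ₜ w) = (U.tensor W').orbit (u ⊗ₜ f w)
  rw [orbit_tmul, orbit_tmul, ← LinearMap.comp_assoc, LinearMap.lTensor_comp_map, hw]

lemma intertwines_rid (W : RightModule k H) :
    Intertwines (W.tensor (unit k H)).act W.act (TensorProduct.rid k W.carrier).toLinearMap := by
  refine intertwines_iff.2 (TensorProduct.ext' fun w (c : k) => ?_)
  have orbit_tmul_unit : (W.tensor (unit k H)).orbit (w ⊗ₜ[k] c) =
      TensorProduct.map (W.orbit w) (c • counit) ∘ₗ comul :=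
    (orbit_tmul (W := unit k H) w c).trans
      (congrArg (TensorProduct.map (W.orbit w) · ∘ₗ comul) (orbit_unit c))
  exact (congrArg _ orbit_tmul_unit).trans <|
    (rid_comp_map_comp_comul (W.orbit w) c).trans (W.orbit.map_smul c w).symm

lemma intertwines_lid (W : RightModule k H) :
    Intertwines ((unit k H).tensor W).act W.act (TensorProduct.lid k W.carrier).toLinearMap := by
  refine intertwines_iff.2 (TensorProduct.ext' fun (c : k) w => ?_)
  have orbit_unit_tmul : ((unit k H).tensor W).orbit (c ⊗ₜ[k] w) =
      TensorProduct.map (c • counit) (W.orbit w) ∘ₗ comul :=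
    (orbit_tmul (U := unit k H) c w).trans
      (congrArg (TensorProduct.map · (W.orbit w) ∘ₗ comul) (orbit_unit c))
  exact (congrArg _ orbit_unit_tmul).trans <|
    (lid_comp_map_comp_comul (W.orbit w) c).trans (W.orbit.map_smul c w).symm

lemma intertwines_assoc (U V W : RightModule k H) :
    Intertwines ((U.tensor V).tensor W).act (U.tensor (V.tensor W)).act
      (TensorProduct.assoc k U.carrier V.carrier W.carrier).toLinearMap := by
  refine intertwines_iff.2 (TensorProduct.ext_threefold fun u v w => ?_)
  have orbit_left : ((U.tensor V).tensor W).orbit ((u ⊗ₜ[k] v) ⊗ₜ[k] w) =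
      TensorProduct.map (TensorProduct.map (U.orbit u) (V.orbit v) ∘ₗ comul) (W.orbit w) ∘ₗ
        comul :=
    (orbit_tmul (U := U.tensor V) (u ⊗ₜ[k] v) w).trans
      (congrArg (TensorProduct.map · (W.orbit w) ∘ₗ comul) (orbit_tmul u v))
  have orbit_right : (U.tensor (V.tensor W)).orbit (u ⊗ₜ[k] (v ⊗ₜ[k] w)) =
      TensorProduct.map (U.orbit u) (TensorProduct.map (V.orbit v) (W.orbit w) ∘ₗ comul) ∘ₗ
        comul :=
    (orbit_tmul (W := V.tensor W) u (v ⊗ₜ[k] w)).trans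
      (congrArg (TensorProduct.map (U.orbit u) · ∘ₗ comul) (orbit_tmul v w))
  exact (congrArg _ orbit_left).trans <|
    (assoc_comp_map_comp_comul (U.orbit u) (V.orbit v) (W.orbit w)).trans orbit_right.symm

end Bialgebra

end RightModule

/-! ### Module depth and tensor powers -/

namespace RightModule

variable {k : Type u} [Field k] {H : Type u} [Ring H]

section Algebra

variable [Algebra k H] {L : Type u} [Ring L] [Algebra k L]

/-- The restriction functor along `f` on homomorphisms. -/
def restrictHom {U W : RightModule k H} (f : L →ₐ[k] H) (φ : U.carrier →ₗ[Hᵐᵒᵖ] W.carrier) :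
    (U.restrict f).carrier →ₗ[Lᵐᵒᵖ] (W.restrict f).carrier :=
  let φ' : (U.restrict f).carrier →ₗ[k] (W.restrict f).carrier := φ.restrictScalars k
  homOfIntertwines φ' ((intertwines_restrictScalars φ).restrict (AlgHom.op f))

lemma dividesMultiple_restrict {U W : RightModule k H}
    (h : DividesMultiple Hᵐᵒᵖ U.carrier W.carrier) (f : L →ₐ[k] H) :
    DividesMultiple Lᵐᵒᵖ (U.restrict f).carrier (W.restrict f).carrier :=
  h.map (restrictHom f) (restrictHom f) fun _ _ _ hfg => hfg

end Algebra

variable [Bialgebra k H]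

section Restrict

open Coalgebra

variable {L : Type u} [Ring L] [Bialgebra k L] (g : L →ₐc[k] H)

lemma restrict_unit : (unit k H).restrict (g : L →ₐ[k] H) = unit k L := by
  unfold unit restrict
  congr 1
  ext l
  simp

lemma restrict_tensor_act (U W : RightModule k H) :
    ((U.tensor W).restrict (g : L →ₐ[k] H)).act =
      ((U.restrict (g : L →ₐ[k] H)).tensor (W.restrict (g : L →ₐ[k] H))).act := by
  refine AlgHom.ext (intertwines_iff (U := (U.tensor W).restrict (g : L →ₐ[k] H))
    (W := (U.restrict (g : L →ₐ[k] H)).tensor (W.restrict (g : L →ₐ[k] H)))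
    (f := LinearMap.id (M := U.carrier ⊗[k] W.carrier)) |>.2 (TensorProduct.ext' fun u w => ?_))
  have orbit_comp : (U.tensor W).orbit (u ⊗ₜ[k] w) ∘ₗ (g : L →ₗ[k] H) =
      TensorProduct.map (U.orbit u ∘ₗ (g : L →ₗ[k] H)) (W.orbit w ∘ₗ (g : L →ₗ[k] H)) ∘ₗ
        comul :=
    (congrArg (· ∘ₗ (g : L →ₗ[k] H)) (orbit_tmul u w)).trans
      (map_comp_comul_comp (U.orbit u) (W.orbit w) g)
  exact orbit_comp.trans (orbit_tmul (U := U.restrict (g : L →ₐ[k] H))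
    (W := W.restrict (g : L →ₐ[k] H)) u w).symm

lemma restrict_tensor (U W : RightModule k H) : (U.tensor W).restrict (g : L →ₐ[k] H) =
    (U.restrict (g : L →ₐ[k] H)).tensor (W.restrict (g : L →ₐ[k] H)) :=
  congrArg (RightModule.mk (U.carrier ⊗[k] W.carrier)) (restrict_tensor_act g U W)

lemma restrict_tpow (W : RightModule k H) (n : ℕ) :
    (W.tpow n).restrict (g : L →ₐ[k] H) = (W.restrict (g : L →ₐ[k] H)).tpow n := by
  induction n with
  | zero => exact restrict_unit g
  | succ n ih => rw [tpow, tpow, restrict_tensor, ih]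

end Restrict

/-- The functor `U ⊗ -` on homomorphisms. -/
def lTensorHom (U : RightModule k H) {V W : RightModule k H}
    (φ : V.carrier →ₗ[Hᵐᵒᵖ] W.carrier) :
    (U.tensor V).carrier →ₗ[Hᵐᵒᵖ] (U.tensor W).carrier :=
  homOfIntertwines (U := U.tensor V) (W := U.tensor W) ((φ.restrictScalars k).lTensor U.carrier)
    (intertwines_lTensor (intertwines_restrictScalars φ) U)

lemma dividesMultiple_lTensor {V W : RightModule k H}
    (h : DividesMultiple Hᵐᵒᵖ V.carrier W.carrier) (U : RightModule k H) :
    DividesMultiple Hᵐᵒᵖ (U.tensor V).carrier (U.tensor W).carrier :=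
  h.map U.lTensorHom U.lTensorHom fun _ f g hfg =>
    sum_lTensor_apply_eq (f := fun i => (f i).restrictScalars k)
      (g := fun i => (g i).restrictScalars k) hfg

lemma dividesMultiple_tpow_succ {W : RightModule k H}
    (hW : DividesMultiple Hᵐᵒᵖ W.carrier (W.tensor W).carrier) (n : ℕ) :
    DividesMultiple Hᵐᵒᵖ (W.tpow (n + 1)).carrier (W.tpow (n + 2)).carrier := by
  refine (dividesMultiple_lTensor hW (W.tpow n)).trans
    (.of_leftInverse (M := ((W.tpow n).tensor (W.tensor W)).carrier)
      (N := (((W.tpow n).tensor W).tensor W).carrier)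
      (homOfIntertwines _ (intertwines_assoc (W.tpow n) W W).symm)
      (homOfIntertwines _ (intertwines_assoc (W.tpow n) W W)) fun t => ?_)
  exact LinearEquiv.apply_symm_apply _ t

lemma dividesMultiple_tpow_of_le {W : RightModule k H}
    (hW : DividesMultiple Hᵐᵒᵖ W.carrier (W.tensor W).carrier) {m n : ℕ} (hmn : m ≤ n) :
    DividesMultiple Hᵐᵒᵖ (W.tpow (m + 1)).carrier (W.tpow (n + 1)).carrier := by
  induction n, hmn using Nat.le_induction with
  | base => exact .refl
  | succ n _ ih => exact ih.trans (dividesMultiple_tpow_succ hW n)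

lemma similar_truncated_tpow {W : RightModule k H}
    (hW : DividesMultiple Hᵐᵒᵖ W.carrier (W.tensor W).carrier) (n : ℕ) :
    Similar Hᵐᵒᵖ (W.truncated n).carrier (W.tpow n).carrier := by
  cases n with
  | zero => exact .of_equiv (.refl _ _)
  | succ n =>
    let e : (W.truncated (n + 1)).carrier ≃ₗ[Hᵐᵒᵖ] ∀ i : Fin (n + 1), (W.tpow (i + 1)).carrier :=
      { AddEquiv.refl _ with map_smul' := fun _ _ => rfl }
    exact (Similar.of_equiv e).trans
      ⟨.pi fun i => dividesMultiple_tpow_of_le hW (Nat.le_of_lt_succ i.2),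
        dividesMultiple_pi (M := fun i : Fin (n + 1) => (W.tpow (i + 1)).carrier) (Fin.last n)⟩

open Coalgebra in
/-- A module dividing a multiple of the unit module is a trivial module, so every vector not
killed by the surjection `s` spans a complement of `ker s`. -/
lemma dividesMultiple_unit_of_surjective {U : RightModule k H}
    (h : DividesMultiple Hᵐᵒᵖ U.carrier (unit k H).carrier)
    (s : U.carrier →ₗ[Hᵐᵒᵖ] (unit k H).carrier) (hs : Function.Surjective s) :
    DividesMultiple Hᵐᵒᵖ (unit k H).carrier U.carrier := by
  obtain ⟨q, f, g, hfg⟩ := h.exists_sum_apply_eq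
  have act_eq (x : Hᵐᵒᵖ) (u : U.carrier) : x • u = counit (R := k) x.unop • u := by
    conv_lhs => rw [← hfg u, Finset.smul_sum]
    conv_rhs => rw [← hfg u, Finset.smul_sum]
    refine Finset.sum_congr rfl fun i _ => ?_
    rw [← map_smul, ← LinearMap.map_smul_of_tower (g i)]
    rfl
  obtain ⟨u, hu⟩ := hs (1 : k)
  have intertwines_span : Intertwines (unit k H).act U.act (LinearMap.toSpanSingleton k _ u) :=
    fun x => LinearMap.ext fun (c : k) =>
      (mul_smul (counit (R := k) x.unop) c u).trans (act_eq x (c • u)).symm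
  refine .of_leftInverse (homOfIntertwines _ intertwines_span) s fun (c : k) => ?_
  exact (LinearMap.map_smul_of_tower s c u).trans ((congrArg (c • ·) hu).trans (mul_one c))

lemma hasModuleDepth_iff_similar {W : RightModule k H}
    (hW : DividesMultiple Hᵐᵒᵖ W.carrier (W.tensor W).carrier)
    (s : W.carrier →ₗ[Hᵐᵒᵖ] (unit k H).carrier) (hs : Function.Surjective s) (n : ℕ) :
    W.HasModuleDepth n ↔ Similar Hᵐᵒᵖ (W.tpow (n + 1)).carrier (W.tpow n).carrier := by
  have dividesMultiple_iff : W.HasModuleDepth n ↔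
      DividesMultiple Hᵐᵒᵖ (W.tpow (n + 1)).carrier (W.tpow n).carrier :=
    ⟨fun h => (similar_truncated_tpow hW _).2.trans (h.trans (similar_truncated_tpow hW n).1),
      fun h => (similar_truncated_tpow hW _).1.trans (h.trans (similar_truncated_tpow hW n).2)⟩
  rw [dividesMultiple_iff]
  refine ⟨fun h => ⟨h, ?_⟩, And.left⟩
  cases n with
  | zero =>
    let lid := homOfIntertwines (U := (unit k H).tensor W) _ (intertwines_lid W)
    exact dividesMultiple_unit_of_surjective h (s ∘ₗ lid)
      (hs.comp (TensorProduct.lid k W.carrier).surjective)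
  | succ n => exact dividesMultiple_tpow_succ hW n

end RightModule

/-! ### The permutation module as a coalgebra -/

namespace HopfSubalgebra

open Coalgebra
open scoped Coalgebra

variable {k : Type u} [Field k] {H : Type u} [Ring H] [HopfAlgebra k H] (R : HopfSubalgebra k H)

/-- The inclusion of a Hopf subalgebra as a homomorphism of bialgebras. -/
def incl : R.toSubalgebra →ₐc[k] H :=
  BialgHom.ofAlgHom R.toSubalgebra.val rfl (AlgHom.ext fun r => R.incl₂_comulHom r)

/-- The projection `H → V = H / R⁺H`. -/
def proj : H →ₗ[k] R.permModule.carrier :=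
  show H →ₗ[k] H ⧸ R.augIdeal from (R.augIdeal.mkQ).restrictScalars k

lemma proj_surjective : Function.Surjective R.proj := R.augIdeal.mkQ_surjective

lemma proj_eq_zero_iff {h : H} : R.proj h = 0 ↔ h ∈ R.augIdeal :=
  Submodule.Quotient.mk_eq_zero R.augIdeal

lemma orbit_proj (g h : H) : R.permModule.orbit (R.proj g) h = R.proj (g * h) := rfl

lemma orbit_proj_one : R.permModule.orbit (R.proj 1) = R.proj :=
  LinearMap.ext fun h => (R.orbit_proj 1 h).trans (congrArg R.proj (one_mul h))

lemma proj_coe_mul (r : R.toSubalgebra) (h : H) :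
    R.proj (r * h) = counit (R := k) r • R.proj h := by
  rw [← map_smul, ← sub_eq_zero, ← map_sub, proj_eq_zero_iff]
  have : (r : H) * h - counit (R := k) r • h =
      op h • ((r : H) - algebraMap k H (counit (R := k) r)) := by
    rw [MulOpposite.smul_eq_mul_unop, unop_op, sub_mul, Algebra.smul_def]
  rw [this]
  refine Submodule.smul_mem _ _ (Submodule.subset_span
    ⟨sub_mem r.2 (Subalgebra.algebraMap_mem _ _), ?_⟩)
  rw [map_sub, Bialgebra.counit_algebraMap, sub_eq_zero]
  rfl

lemma proj_comp_val :
    R.proj ∘ₗ R.toSubalgebra.val.toLinearMap = counit.smulRight (R.proj 1) :=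
  LinearMap.ext fun r => by simpa using R.proj_coe_mul r 1

section Lift

variable {R} {W : RightModule k H}

/-- The homomorphism `V → W` with `1 ↦ w`, where `R` acts on `w` through the counit. -/
def permLift (w : W.carrier)
    (hw : W.orbit w ∘ₗ R.toSubalgebra.val.toLinearMap = counit.smulRight w) :
    R.permModule.carrier →ₗ[Hᵐᵒᵖ] W.carrier :=
  let f : H →ₗ[Hᵐᵒᵖ] W.carrier :=
    { W.orbit w with
      map_smul' := fun h g => LinearMap.congr_fun (map_mul W.act h (op g)) w }
  let g : H ⧸ R.augIdeal →ₗ[Hᵐᵒᵖ] W.carrier := R.augIdeal.liftQ f <|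
    Submodule.span_le.2 fun r hr =>
      (LinearMap.congr_fun hw ⟨r, hr.1⟩).trans <|
        (congrArg (· • w) hr.2).trans (zero_smul k w)
  { toFun := g, map_add' := map_add g, map_smul' := map_smul g }

end Lift

/-- The augmentation of `V`, induced by the counit of `H`. -/
def augmentation : R.permModule.carrier →ₗ[Hᵐᵒᵖ] (RightModule.unit k H).carrier :=
  permLift (W := RightModule.unit k H) (1 : k) (LinearMap.ext fun _ => rfl)

lemma augmentation_proj (h : H) : R.augmentation (R.proj h) = counit (R := k) h :=
  mul_one (counit (R := k) h)

lemma augmentation_surjective : Function.Surjective R.augmentation := fun c =>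
  ⟨R.proj (algebraMap k H c), (R.augmentation_proj _).trans
    (Bialgebra.counit_algebraMap (R := k) (A := H) c)⟩

lemma orbit_proj_one_tmul_proj_one :
    (R.permModule.tensor R.permModule).orbit (R.proj 1 ⊗ₜ[k] R.proj 1) =
      TensorProduct.map R.proj R.proj ∘ₗ comul :=
  (RightModule.orbit_tmul _ _).trans (by rw [orbit_proj_one])

/-- The comultiplication `V → V ⊗ V` induced by that of `H`. -/
def permComul :
    R.permModule.carrier →ₗ[Hᵐᵒᵖ] (R.permModule.tensor R.permModule).carrier :=
  permLift (W := R.permModule.tensor R.permModule) (R.proj 1 ⊗ₜ[k] R.proj 1) <| by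
    have map_proj_comp_comul : (TensorProduct.map R.proj R.proj ∘ₗ comul) ∘ₗ
          R.toSubalgebra.val.toLinearMap = counit.smulRight (R.proj 1 ⊗ₜ[k] R.proj 1) :=
      calc
        _ = TensorProduct.map (counit.smulRight (R.proj 1)) (counit.smulRight (R.proj 1)) ∘ₗ
            comul := by
          rw [← proj_comp_val]
          exact map_comp_comul_comp R.proj R.proj R.incl
        _ = _ := by
          rw [map_counit_smulRight_comp_comul]
          ext r
          simp
    exact (congrArg (· ∘ₗ R.toSubalgebra.val.toLinearMap) R.orbit_proj_one_tmul_proj_one).trans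
      map_proj_comp_comul

lemma permComul_proj (h : H) :
    R.permComul (R.proj h) = TensorProduct.map R.proj R.proj (comul h) :=
  LinearMap.congr_fun R.orbit_proj_one_tmul_proj_one h

/-- The comultiplication of `V` is split by `id ⊗ ε`. -/
lemma dividesMultiple_permModule_tensor : DividesMultiple Hᵐᵒᵖ R.permModule.carrier
    (R.permModule.tensor R.permModule).carrier := by
  let V := R.permModule
  let rid := RightModule.homOfIntertwines (U := V.tensor (.unit k H)) _ V.intertwines_rid
  refine .of_leftInverse R.permComul (rid ∘ₗ V.lTensorHom R.augmentation) fun v => ?_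
  obtain ⟨h, rfl⟩ := R.proj_surjective v
  have augmentation_comp_proj : R.augmentation.restrictScalars k ∘ₗ R.proj =
      (RightModule.unit k H).orbit (1 : k) :=
    LinearMap.ext fun h => (R.augmentation_proj h).trans (mul_one (counit (R := k) h)).symm
  have rid_map_comul : TensorProduct.rid k V.carrier (TensorProduct.map R.proj
      (R.augmentation.restrictScalars k ∘ₗ R.proj) (comul h)) = R.proj h :=
    (congrArg (fun f => TensorProduct.rid k V.carrier (TensorProduct.map R.proj f (comul h)))
      (augmentation_comp_proj.trans (RightModule.orbit_unit 1))).trans <|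
      (LinearMap.congr_fun (rid_comp_map_comp_comul R.proj (1 : k)) h).trans
        (one_smul k (R.proj h))
  refine Eq.trans (congrArg (rid ∘ₗ V.lTensorHom R.augmentation) (R.permComul_proj h)) ?_
  exact (congrArg (TensorProduct.rid k V.carrier) (LinearMap.congr_fun
    (LinearMap.lTensor_comp_map _ _ R.proj R.proj) (comul h))).trans rid_map_comul

lemma hasModuleDepth_iff (n : ℕ) : R.permModule.HasModuleDepth n ↔
    Similar Hᵐᵒᵖ (R.permModule.tpow (n + 1)).carrier (R.permModule.tpow n).carrier :=
  RightModule.hasModuleDepth_iff_similar R.dividesMultiple_permModule_tensor R.augmentation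
    R.augmentation_surjective n

lemma hasModuleDepth_restrict_iff (n : ℕ) :
    (R.permModule.restrict R.toSubalgebra.val).HasModuleDepth n ↔
      Similar R.toSubalgebraᵐᵒᵖ ((R.permModule.tpow (n + 1)).restrict R.toSubalgebra.val).carrier
        ((R.permModule.tpow n).restrict R.toSubalgebra.val).carrier := by
  have restrict_tpow (n : ℕ) : (R.permModule.tpow n).restrict R.toSubalgebra.val =
      (R.permModule.restrict R.toSubalgebra.val).tpow n :=
    RightModule.restrict_tpow R.incl R.permModule n
  have restrict_tensor : (R.permModule.tensor R.permModule).restrict R.toSubalgebra.val =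
      (R.permModule.restrict R.toSubalgebra.val).tensor
        (R.permModule.restrict R.toSubalgebra.val) :=
    RightModule.restrict_tensor R.incl R.permModule R.permModule
  have hV := RightModule.dividesMultiple_restrict R.dividesMultiple_permModule_tensor
    R.toSubalgebra.val
  rw [restrict_tensor] at hV
  rw [restrict_tpow, restrict_tpow]
  exact RightModule.hasModuleDepth_iff_similar hV
    (RightModule.restrictHom R.toSubalgebra.val R.augmentation) R.augmentation_surjective n

end HopfSubalgebra

/-! ### Isomorphisms and twists of bimodules -/

namespace Bimodule

variable {k : Type u} [Field k] {X Y : Type u} [Ring X] [Algebra k X] [Ring Y] [Algebra k Y]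

lemma tmul_smul (M : Bimodule k X Y) (x : X) (y : Yᵐᵒᵖ) (m : M.carrier) :
    (x ⊗ₜ[k] y) • m = M.left x (M.right y m) :=
  LinearMap.congr_fun (Algebra.TensorProduct.lift_tmul M.left M.right M.comm x y) m

lemma tmul_one_smul (M : Bimodule k X Y) (x : X) (m : M.carrier) :
    (x ⊗ₜ[k] (1 : Yᵐᵒᵖ)) • m = M.left x m := by
  rw [tmul_smul, map_one, Module.End.one_apply]

lemma one_tmul_smul (M : Bimodule k X Y) (y : Yᵐᵒᵖ) (m : M.carrier) :
    ((1 : X) ⊗ₜ[k] y) • m = M.right y m := by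
  rw [tmul_smul, map_one, Module.End.one_apply]

instance (M : Bimodule k X Y) : IsScalarTower k (X ⊗[k] Yᵐᵒᵖ) M.carrier :=
  ⟨fun c e m => LinearMap.congr_fun
    (map_smul (Algebra.TensorProduct.lift M.left M.right M.comm) c e) m⟩

/-- A linear map commuting with both actions, as a homomorphism of modules over `X ⊗ Yᵐᵒᵖ`. -/
def homOfIntertwines {M N : Bimodule k X Y} (f : M.carrier →ₗ[k] N.carrier)
    (hl : Intertwines M.left N.left f) (hr : Intertwines M.right N.right f) :
    M.carrier →ₗ[X ⊗[k] Yᵐᵒᵖ] N.carrier :=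
  { f with
    map_smul' := fun e m => by
      change f (e • m) = e • f m
      induction e with
      | zero =>
        exact (congrArg f (zero_smul (X ⊗[k] Yᵐᵒᵖ) m)).trans <|
          (map_zero f).trans (zero_smul (X ⊗[k] Yᵐᵒᵖ) (f m)).symm
      | add a b ha hb => rw [add_smul, add_smul, map_add, ha, hb]
      | tmul x y => rw [tmul_smul, tmul_smul, hl.apply, hr.apply] }

/-- Isomorphisms of bimodules. -/
structure Iso (M N : Bimodule k X Y) where
  equiv : M.carrier ≃ₗ[k] N.carrier
  left : Intertwines M.left N.left equiv.toLinearMap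
  right : Intertwines M.right N.right equiv.toLinearMap

namespace Iso

variable {M N P : Bimodule k X Y}

/-- Composition of isomorphisms of bimodules. -/
def trans (e : Iso M N) (e' : Iso N P) : Iso M P where
  equiv := e.equiv.trans e'.equiv
  left := e'.left.comp e.left
  right := e'.right.comp e.right

/-- Restriction of scalars of an isomorphism of bimodules. -/
def restrict {X' Y' : Type u} [Ring X'] [Algebra k X'] [Ring Y'] [Algebra k Y'] (e : Iso M N)
    (f : X' →ₐ[k] X) (g : Y' →ₐ[k] Y) : Iso (M.restrict f g) (N.restrict f g) where
  equiv := e.equiv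
  left := e.left.restrict f
  right := e.right.restrict (AlgHom.op g)

/-- An isomorphism of bimodules as an equivalence of modules over `X ⊗ Yᵐᵒᵖ`. -/
def toLinearEquiv (e : Iso M N) : M.carrier ≃ₗ[X ⊗[k] Yᵐᵒᵖ] N.carrier :=
  .ofLinearMap (homOfIntertwines _ e.left e.right) (homOfIntertwines _ e.left.symm e.right.symm)
    (LinearMap.ext e.equiv.apply_symm_apply) (LinearMap.ext e.equiv.symm_apply_apply)

end Iso

/-- The right module underlying a bimodule. -/
def toRight (M : Bimodule k X Y) : RightModule k Y where
  carrier := M.carrier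
  act := M.right

section Twist

variable {H : Type u} [Ring H] [Bialgebra k H]

/-- The bimodule `M ⊗ W`, with the left action on `M` and the diagonal right action. -/
def twist (M : Bimodule k X H) (W : RightModule k H) : Bimodule k X H where
  carrier := M.carrier ⊗[k] W.carrier
  left := (Module.End.rTensorAlgHom k M.carrier W.carrier).comp M.left
  right := (M.toRight.tensor W).act
  comm x := RightModule.intertwines_rTensor (U := M.toRight) (U' := M.toRight) (M.comm x) W

/-- Twisting by `W` on isomorphisms. -/
def Iso.twist {M N : Bimodule k X H} (e : Iso M N) (W : RightModule k H) :
    Iso (M.twist W) (N.twist W) where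
  equiv := TensorProduct.congr e.equiv (.refl k W.carrier)
  left x := by
    change e.equiv.toLinearMap.rTensor W.carrier ∘ₗ (M.left x).rTensor W.carrier =
      (N.left x).rTensor W.carrier ∘ₗ e.equiv.toLinearMap.rTensor W.carrier
    rw [← LinearMap.rTensor_comp, e.left, LinearMap.rTensor_comp]
  right := RightModule.intertwines_rTensor (U := M.toRight) (U' := N.toRight) e.right W

/-- Twisting by `U` and then by `W` is twisting by `U ⊗ W`. -/
def twistTwist (M : Bimodule k X H) (U W : RightModule k H) :
    Iso ((M.twist U).twist W) (M.twist (U.tensor W)) where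
  equiv := TensorProduct.assoc k M.carrier U.carrier W.carrier
  left _ := TensorProduct.ext_threefold fun _ _ _ => rfl
  right := RightModule.intertwines_assoc M.toRight U W

/-- Twisting by the unit module does nothing. -/
def twistUnit (M : Bimodule k X H) : Iso M (M.twist (RightModule.unit k H)) where
  equiv := (TensorProduct.rid k M.carrier).symm
  left _ := LinearMap.ext fun _ => rfl
  right := (RightModule.intertwines_rid M.toRight).symm

variable {L : Type u} [Ring L] [Bialgebra k L]

lemma restrict_twist (M : Bimodule k X H) (W : RightModule k H) (f : Y →ₐ[k] X)
    (g : L →ₐc[k] H) : (M.twist W).restrict f (g : L →ₐ[k] H) =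
      (M.restrict f (g : L →ₐ[k] H)).twist (W.restrict (g : L →ₐ[k] H)) := by
  have right_eq := RightModule.restrict_tensor_act g M.toRight W
  unfold Bimodule.restrict twist
  congr 1

/-- The functor `M ⊗ -` on homomorphisms. -/
def twistHom (M : Bimodule k X H) {U W : RightModule k H} (φ : U.carrier →ₗ[Hᵐᵒᵖ] W.carrier) :
    (M.twist U).carrier →ₗ[X ⊗[k] Hᵐᵒᵖ] (M.twist W).carrier :=
  homOfIntertwines (M := M.twist U) (N := M.twist W) ((φ.restrictScalars k).lTensor M.carrier)
    (fun _ => TensorProduct.ext' fun _ _ => rfl)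
    (RightModule.intertwines_lTensor (RightModule.intertwines_restrictScalars φ) M.toRight)

lemma dividesMultiple_twist (M : Bimodule k X H) {U W : RightModule k H}
    (h : DividesMultiple Hᵐᵒᵖ U.carrier W.carrier) :
    DividesMultiple (X ⊗[k] Hᵐᵒᵖ) (M.twist U).carrier (M.twist W).carrier :=
  h.map M.twistHom M.twistHom fun _ f g hfg =>
    sum_lTensor_apply_eq (f := fun i => (f i).restrictScalars k)
      (g := fun i => (g i).restrictScalars k) hfg

lemma similar_twist (M : Bimodule k X H) {U W : RightModule k H}
    (h : Similar Hᵐᵒᵖ U.carrier W.carrier) :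
    Similar (X ⊗[k] Hᵐᵒᵖ) (M.twist U).carrier (M.twist W).carrier :=
  ⟨M.dividesMultiple_twist h.1, M.dividesMultiple_twist h.2⟩

end Twist

end Bimodule

/-! ### Coinvariants -/

section Coinvariants

variable {k E E' N N' W W' : Type*} [CommRing k] [Ring E] [Algebra k E] [Ring E'] [AddCommGroup N]
  [Module k N] [Module E N] [IsScalarTower k E N] [AddCommGroup N'] [Module k N'] [Module E N']
  [IsScalarTower k E N'] [AddCommGroup W] [Module k W] [Module E' W] [AddCommGroup W']
  [Module k W'] [Module E' W']

/-- The map `π` exhibits `W` as the quotient of the `E`-module `N` by the span of `I N`, where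
`e' : E'` acts on the quotient through `σ e' : E`. The map `σ` need not be multiplicative: it only
has to induce the action of `E'`. -/
structure IsCoinvariants (σ : E' → E) (I : Set E) (π : N →ₗ[k] W) : Prop where
  surjective : Function.Surjective π
  map_smul : ∀ e n, π (σ e • n) = e • π n
  ker_eq : LinearMap.ker π = .span k {m | ∃ i ∈ I, ∃ n : N, i • n = m}

namespace IsCoinvariants

variable {σ : E' → E} {I : Set E} {π : N →ₗ[k] W} {π' : N' →ₗ[k] W'}

lemma exists_desc (h : IsCoinvariants σ I π) (h' : IsCoinvariants σ I π') (f : N →ₗ[E] N') :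
    ∃ g : W →ₗ[E'] W', ∀ n, g (π n) = π' (f n) := by
  have ker_le : LinearMap.ker π ≤ LinearMap.ker (π' ∘ₗ f.restrictScalars k) := by
    rw [h.ker_eq, Submodule.span_le]
    rintro _ ⟨i, hi, n, rfl⟩
    have smul_mem_ker : i • f n ∈ LinearMap.ker π' :=
      h'.ker_eq.symm ▸ Submodule.subset_span ⟨i, hi, f n, rfl⟩
    exact (congrArg π' (f.map_smul i n)).trans smul_mem_ker
  let g : W →ₗ[k] W' := (LinearMap.ker π).liftQ _ ker_le ∘ₗ
    (π.quotKerEquivOfSurjective h.surjective).symm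
  have g_apply (n : N) : g (π n) = π' (f n) :=
    congrArg ((LinearMap.ker π).liftQ _ ker_le)
      ((π.quotKerEquivOfSurjective h.surjective).symm_apply_apply (Submodule.Quotient.mk n))
  refine ⟨{ g with map_smul' := fun e w => ?_ }, g_apply⟩
  obtain ⟨n, rfl⟩ := h.surjective w
  calc g (e • π n) = π' (f (σ e • n)) := by rw [← h.map_smul, g_apply]
    _ = e • g (π n) := by rw [_root_.map_smul, h'.map_smul, g_apply]

lemma dividesMultiple (h : IsCoinvariants σ I π) (h' : IsCoinvariants σ I π')
    (hN : DividesMultiple E N N') : DividesMultiple E' W W' := by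
  choose F hF using h.exists_desc h'
  choose G hG using h'.exists_desc h
  refine hN.map F G fun q f g hfg w => ?_
  obtain ⟨n, rfl⟩ := h.surjective w
  simp only [hF, hG, ← map_sum, hfg]

lemma similar (h : IsCoinvariants σ I π) (h' : IsCoinvariants σ I π')
    (hN : Similar E N N') : Similar E' W W' :=
  ⟨h.dividesMultiple h' hN.1, h'.dividesMultiple h hN.2⟩

end IsCoinvariants

end Coinvariants

namespace Bimodule

variable {k : Type u} [Field k] {X Y : Type u} [Ring X] [Algebra k X] [Ring Y]

/-- The map `π` exhibits the right module `W` as the quotient of the bimodule `N` by the span of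
`J N`. -/
structure IsLeftCoinvariants [Algebra k Y] (J : Set X) (N : Bimodule k X Y) (W : RightModule k Y)
    (π : N.carrier →ₗ[k] W.carrier) : Prop where
  surjective : Function.Surjective π
  intertwines : Intertwines N.right W.act π
  ker_eq : LinearMap.ker π = .span k {m | ∃ x ∈ J, ∃ n, N.left x n = m}

namespace IsLeftCoinvariants

section Algebra

variable [Algebra k Y] {J : Set X} {N N' : Bimodule k X Y} {W W' : RightModule k Y}
  {π : N.carrier →ₗ[k] W.carrier} {π' : N'.carrier →ₗ[k] W'.carrier}

lemma isCoinvariants (h : IsLeftCoinvariants J N W π) :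
    IsCoinvariants (fun y : Yᵐᵒᵖ => (1 : X) ⊗ₜ[k] y) ((· ⊗ₜ[k] (1 : Yᵐᵒᵖ)) '' J) π where
  surjective := h.surjective
  map_smul y n := (congrArg π (N.one_tmul_smul y n)).trans (h.intertwines.apply y n)
  ker_eq := by simp only [h.ker_eq, Set.exists_mem_image, tmul_one_smul]

lemma similar (h : IsLeftCoinvariants J N W π) (h' : IsLeftCoinvariants J N' W' π')
    (hN : Similar (X ⊗[k] Yᵐᵒᵖ) N.carrier N'.carrier) : Similar Yᵐᵒᵖ W.carrier W'.carrier :=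
  h.isCoinvariants.similar h'.isCoinvariants hN

lemma restrict {L : Type u} [Ring L] [Algebra k L] (h : IsLeftCoinvariants J N W π)
    (g : L →ₐ[k] Y) : IsLeftCoinvariants J (N.restrict (.id k X) g) (W.restrict g) π where
  surjective := h.surjective
  intertwines := h.intertwines.restrict (AlgHom.op g)
  ker_eq := h.ker_eq

lemma congr (h : IsLeftCoinvariants J N W π) (e : W.carrier ≃ₗ[k] W'.carrier)
    (he : Intertwines W.act W'.act e.toLinearMap) :
    IsLeftCoinvariants J N W' (e.toLinearMap ∘ₗ π) where
  surjective := e.surjective.comp h.surjective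
  intertwines := he.comp h.intertwines
  ker_eq := (LinearEquiv.ker_comp e π).trans h.ker_eq

lemma of_iso (h : IsLeftCoinvariants J N W π) (e : Iso N' N) :
    IsLeftCoinvariants J N' W (π ∘ₗ e.equiv.toLinearMap) where
  surjective := h.surjective.comp e.equiv.surjective
  intertwines := h.intertwines.comp e.right
  ker_eq := by
    rw [LinearMap.ker_comp, h.ker_eq, Submodule.comap_equiv_eq_map_symm, Submodule.map_span]
    congr 1
    ext m
    constructor
    · rintro ⟨_, ⟨x, hx, n, rfl⟩, rfl⟩
      exact ⟨x, hx, _, (e.left.symm.apply x n).symm⟩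
    · rintro ⟨x, hx, n, rfl⟩
      exact ⟨_, ⟨x, hx, e.equiv n, rfl⟩,
        (e.left.symm.apply x (e.equiv n)).trans (congrArg _ (e.equiv.symm_apply_apply n))⟩

end Algebra

variable [Bialgebra k Y] {J : Set X} {N : Bimodule k X Y} {W : RightModule k Y}
  {π : N.carrier →ₗ[k] W.carrier}

lemma twist (h : IsLeftCoinvariants J N W π) (U : RightModule k Y) :
    IsLeftCoinvariants J (N.twist U) (W.tensor U) (π.rTensor U.carrier) where
  surjective := LinearMap.rTensor_surjective _ h.surjective
  intertwines := RightModule.intertwines_rTensor (U := N.toRight) h.intertwines U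
  ker_eq := by
    refine (ker_rTensor_eq_span h.surjective h.ker_eq U.carrier).trans (le_antisymm ?_ ?_)
    · refine Submodule.span_mono ?_
      rintro _ ⟨_, ⟨x, hx, n, rfl⟩, u, -, rfl⟩
      exact ⟨x, hx, n ⊗ₜ u, rfl⟩
    · refine Submodule.span_le.2 ?_
      rintro _ ⟨x, hx, t, rfl⟩
      refine TensorProduct.induction_on (motive := fun t => (N.left x).rTensor U.carrier t ∈
        Submodule.span k (Set.image2 (· ⊗ₜ[k] ·) _ .univ)) t ?_ (fun n u => ?_) fun a b ha hb => ?_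
      · exact (map_zero ((N.left x).rTensor U.carrier)).symm ▸ zero_mem _
      · exact Submodule.subset_span ⟨_, ⟨x, hx, n, rfl⟩, u, trivial, rfl⟩
      · exact (map_add ((N.left x).rTensor U.carrier) a b).symm ▸ add_mem ha hb

end IsLeftCoinvariants

end Bimodule

namespace Bimodule

open Coalgebra

variable {k : Type u} [Field k] {A : Type u} [Ring A] [Bialgebra k A]

variable (k A) in
lemma isLeftCoinvariants_counit : IsLeftCoinvariants {a : A | counit (R := k) a = 0}
    (regular k A) (RightModule.unit k A) (counit (R := k) (A := A)) where
  surjective c := ⟨algebraMap k A c, Bialgebra.counit_algebraMap (R := k) (A := A) c⟩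
  intertwines _ := LinearMap.ext fun a : A =>
    (Bialgebra.counit_mul (R := k) a _).trans (mul_comm _ _)
  ker_eq := by
    refine le_antisymm (fun a ha => ?_) (Submodule.span_le.2 ?_)
    · exact Submodule.subset_span ⟨a, ha, (1 : A), mul_one (show A from a)⟩
    · rintro _ ⟨a, ha, b, rfl⟩
      exact (Bialgebra.counit_mul (R := k) (A := A) a b).trans (mul_eq_zero_of_left ha _)

lemma isLeftCoinvariants_regular_twist (W : RightModule k A) :
    IsLeftCoinvariants {a : A | counit (R := k) a = 0} ((regular k A).twist W) W
      ((TensorProduct.lid k W.carrier).toLinearMap ∘ₗ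
        (counit (R := k) (A := A)).rTensor W.carrier) :=
  ((isLeftCoinvariants_counit k A).twist W).congr (W := (RightModule.unit k A).tensor W)
    (TensorProduct.lid k W.carrier) (RightModule.intertwines_lid W)

lemma similar_restrict_regular_twist_iff {L : Type u} [Ring L] [Bialgebra k L] (g : L →ₐc[k] A)
    (W W' : RightModule k A) :
    Similar (A ⊗[k] Lᵐᵒᵖ) (((regular k A).twist W).restrict (.id k A) g.toAlgHom).carrier
        (((regular k A).twist W').restrict (.id k A) g.toAlgHom).carrier ↔
      Similar Lᵐᵒᵖ (W.restrict g.toAlgHom).carrier (W'.restrict g.toAlgHom).carrier := by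
  refine ⟨IsLeftCoinvariants.similar ((isLeftCoinvariants_regular_twist W).restrict g.toAlgHom)
    ((isLeftCoinvariants_regular_twist W').restrict g.toAlgHom), fun h => ?_⟩
  rw [restrict_twist, restrict_twist]
  exact similar_twist _ h

end Bimodule

namespace HopfSubalgebra

open Coalgebra

variable {k : Type u} [Field k] {H : Type u} [Ring H] [HopfAlgebra k H] (R : HopfSubalgebra k H)

lemma ker_proj : LinearMap.ker R.proj =
    .span k {h | ∃ r ∈ {r : R.toSubalgebra | counit (R := k) r = 0}, ∃ g : H, r * g = h} := by
  refine le_antisymm (fun h hh => ?_) (Submodule.span_le.2 ?_)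
  · exact Submodule.closure_induction (zero_mem _) (fun _ _ _ _ => add_mem)
      (fun g r hr => Submodule.subset_span ⟨⟨r, hr.1⟩, hr.2, g.unop, rfl⟩)
      (R.proj_eq_zero_iff.1 hh)
  · rintro _ ⟨r, hr, g, rfl⟩
    exact (R.proj_coe_mul r g).trans ((congrArg (· • R.proj g) hr).trans (zero_smul k _))

lemma isLeftCoinvariants_proj : Bimodule.IsLeftCoinvariants
    {r : R.toSubalgebra | counit (R := k) r = 0}
    ((Bimodule.regular k H).restrict R.toSubalgebra.val (.id k H)) R.permModule R.proj where
  surjective := R.proj_surjective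
  intertwines _ := LinearMap.ext fun _ => rfl
  ker_eq := R.ker_proj

end HopfSubalgebra

/-! ### The Galois isomorphism -/

section Shear

open Coalgebra
open scoped Coalgebra

variable {k C M : Type*} [CommRing k] [AddCommGroup C] [Module k C] [Coalgebra k C]
  [AddCommGroup M] [Module k M]

/-- The endomorphism `m ⊗ c ↦ ∑ f m c₍₁₎ ⊗ c₍₂₎` of `M ⊗ C`. -/
def shearLeft (f : M →ₗ[k] C →ₗ[k] M) : M ⊗[k] C →ₗ[k] M ⊗[k] C :=
  (TensorProduct.lift f).rTensor C ∘ₗ (TensorProduct.assoc k M C C).symm.toLinearMap ∘ₗ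
    comul.lTensor M

/-- The endomorphism `c ⊗ m ↦ ∑ c₍₁₎ ⊗ f m c₍₂₎` of `C ⊗ M`. -/
def shearRight (f : M →ₗ[k] C →ₗ[k] M) : C ⊗[k] M →ₗ[k] C ⊗[k] M :=
  (TensorProduct.lift f.flip).lTensor C ∘ₗ (TensorProduct.assoc k C C M).toLinearMap ∘ₗ
    comul.rTensor M

lemma shearLeft_tmul (f : M →ₗ[k] C →ₗ[k] M) (m : M) (c : C) :
    shearLeft f (m ⊗ₜ[k] c) = (f m).rTensor C (comul c) := by
  have (t : C ⊗[k] C) : (TensorProduct.lift f).rTensor C ((TensorProduct.assoc k M C C).symm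
      (m ⊗ₜ[k] t)) = (f m).rTensor C t := by
    induction t with
    | zero => simp
    | tmul a b => simp
    | add s t hs ht => rw [TensorProduct.tmul_add, map_add, map_add, map_add, hs, ht]
  exact this (comul c)

lemma shearRight_tmul (f : M →ₗ[k] C →ₗ[k] M) (c : C) (m : M) :
    shearRight f (c ⊗ₜ[k] m) = (f m).lTensor C (comul c) := by
  have (t : C ⊗[k] C) : (TensorProduct.lift f.flip).lTensor C (TensorProduct.assoc k C C M
      (t ⊗ₜ[k] m)) = (f m).lTensor C t := by
    induction t with
    | zero => simp
    | tmul a b => simp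
    | add s t hs ht => rw [TensorProduct.add_tmul, map_add, map_add, map_add, hs, ht]
  exact this (comul c)

variable {f g : M →ₗ[k] C →ₗ[k] M}

lemma shearLeft_comp_shearLeft
    (h : ∀ m, TensorProduct.lift f ∘ₗ (g m).rTensor C ∘ₗ comul = counit.smulRight m) :
    shearLeft f ∘ₗ shearLeft g = .id := by
  refine TensorProduct.ext' fun m c => ?_
  have coassoc_apply : (TensorProduct.assoc k M C C).symm
      (comul.lTensor M ((g m).rTensor C (comul c))) =
        ((g m).rTensor C ∘ₗ comul).rTensor C (comul c) := by
    rw [LinearEquiv.symm_apply_eq, ← LinearMap.comp_apply (comul.lTensor M),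
      LinearMap.lTensor_comp_rTensor]
    simpa [LinearMap.rTensor, TensorProduct.map_id] using
      (LinearMap.congr_fun (assoc_comp_map_comp_comul (g m) .id .id) c).symm
  calc shearLeft f (shearLeft g (m ⊗ₜ c))
      = (TensorProduct.lift f ∘ₗ (g m).rTensor C ∘ₗ comul).rTensor C (comul c) := by
        rw [shearLeft_tmul, LinearMap.rTensor_comp, LinearMap.comp_apply, ← coassoc_apply]
        rfl
    _ = m ⊗ₜ c := by
        rw [h]
        exact LinearMap.congr_fun (map_counit_smulRight_comp_comul m .id) c

lemma shearRight_comp_shearRight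
    (h : ∀ m, TensorProduct.lift f.flip ∘ₗ (g m).lTensor C ∘ₗ comul = counit.smulRight m) :
    shearRight f ∘ₗ shearRight g = .id := by
  refine TensorProduct.ext' fun c m => ?_
  have coassoc_apply : TensorProduct.assoc k C C M
      (comul.rTensor M ((g m).lTensor C (comul c))) =
        ((g m).lTensor C ∘ₗ comul).lTensor C (comul c) := by
    rw [← LinearMap.comp_apply (comul.rTensor M), LinearMap.rTensor_comp_lTensor]
    simpa [LinearMap.lTensor, TensorProduct.map_id] using
      LinearMap.congr_fun (assoc_comp_map_comp_comul .id .id (g m)) c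
  calc shearRight f (shearRight g (c ⊗ₜ m))
      = (TensorProduct.lift f.flip ∘ₗ (g m).lTensor C ∘ₗ comul).lTensor C (comul c) := by
        rw [shearRight_tmul, LinearMap.lTensor_comp, LinearMap.comp_apply, ← coassoc_apply]
        rfl
    _ = c ⊗ₜ m := by
        rw [h]
        exact LinearMap.congr_fun (map_smulRight_counit_comp_comul .id m) c

end Shear

namespace RightModule

open Coalgebra HopfAlgebra

variable {k : Type u} [Field k] {H : Type u} [Ring H]

section Algebra

variable [Algebra k H] (W : RightModule k H)

lemma orbit_mul (w : W.carrier) (g h : H) : W.orbit w (g * h) = W.orbit (W.orbit w g) h :=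
  LinearMap.congr_fun (map_mul W.act (op h) (op g)) w

lemma lift_orbit_comp_rTensor_orbit (w : W.carrier) :
    TensorProduct.lift W.orbit ∘ₗ (W.orbit w).rTensor H = W.orbit w ∘ₗ LinearMap.mul' k H :=
  TensorProduct.ext' fun g h => (W.orbit_mul w g h).symm

lemma orbit_one (w : W.carrier) : W.orbit w 1 = w :=
  LinearMap.congr_fun (map_one W.act) w

end Algebra

variable [HopfAlgebra k H] (W : RightModule k H)

lemma shearLeft_orbit_comp_shearLeft_orbit_antipode :
    shearLeft W.orbit ∘ₗ shearLeft (W.orbit.compl₂ (antipode k)) = .id := by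
  refine shearLeft_comp_shearLeft fun w => LinearMap.ext fun h => ?_
  calc TensorProduct.lift W.orbit ((W.orbit w ∘ₗ antipode k).rTensor H (comul h))
      = W.orbit w (LinearMap.mul' k H ((antipode k).rTensor H (comul h))) := by
        rw [LinearMap.rTensor_comp, LinearMap.comp_apply, ← LinearMap.comp_apply,
          lift_orbit_comp_rTensor_orbit, LinearMap.comp_apply]
    _ = counit (R := k) h • w := by
        rw [mul_antipode_rTensor_comul_apply, Algebra.algebraMap_eq_smul_one, map_smul, orbit_one]

lemma shearLeft_orbit_antipode_comp_shearLeft_orbit :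
    shearLeft (W.orbit.compl₂ (antipode k)) ∘ₗ shearLeft W.orbit = .id := by
  refine shearLeft_comp_shearLeft fun w => LinearMap.ext fun h => ?_
  have lift_compl₂ : TensorProduct.lift (W.orbit.compl₂ (antipode k)) ∘ₗ (W.orbit w).rTensor H =
      W.orbit w ∘ₗ LinearMap.mul' k H ∘ₗ (antipode k).lTensor H :=
    TensorProduct.ext' fun x y => (W.orbit_mul w x _).symm
  calc TensorProduct.lift (W.orbit.compl₂ (antipode k)) ((W.orbit w).rTensor H (comul h))
      = W.orbit w (LinearMap.mul' k H ((antipode k).lTensor H (comul h))) :=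
        LinearMap.congr_fun lift_compl₂ (comul h)
    _ = counit (R := k) h • w := by
        rw [mul_antipode_lTensor_comul_apply, Algebra.algebraMap_eq_smul_one, map_smul, orbit_one]

end RightModule

namespace HopfSubalgebra

open Coalgebra HopfAlgebra
open scoped Coalgebra

variable {k : Type u} [Field k] {X H : Type u} [Ring X] [Algebra k X] [Ring H] [HopfAlgebra k H]
  (R : HopfSubalgebra k H) (U : RightModule k H)

/-- The Galois map `U ⊗ H → U ⊗ V`, `u ⊗ h ↦ ∑ u h₍₁₎ ⊗ h₍₂₎`. -/
def galoisMap : U.carrier ⊗[k] H →ₗ[k] (U.tensor R.permModule).carrier :=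
  R.proj.lTensor U.carrier ∘ₗ shearLeft U.orbit

lemma galoisMap_surjective : Function.Surjective (R.galoisMap U) :=
  (LinearMap.lTensor_surjective _ R.proj_surjective).comp <|
    Function.RightInverse.surjective <| LinearMap.congr_fun
      U.shearLeft_orbit_comp_shearLeft_orbit_antipode

lemma orbit_tmul_proj_one (u : U.carrier) :
    (U.tensor R.permModule).orbit (u ⊗ₜ[k] R.proj 1) =
      TensorProduct.map (U.orbit u) R.proj ∘ₗ comul :=
  (RightModule.orbit_tmul _ _).trans (by rw [orbit_proj_one])

lemma galoisMap_tmul (u : U.carrier) (h : H) :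
    R.galoisMap U (u ⊗ₜ[k] h) = (U.tensor R.permModule).orbit (u ⊗ₜ[k] R.proj 1) h := by
  rw [orbit_tmul_proj_one]
  exact (congrArg (R.proj.lTensor U.carrier) (shearLeft_tmul U.orbit u h)).trans
    (LinearMap.congr_fun (LinearMap.lTensor_comp_rTensor _ _ _) (comul h))

lemma orbit_galoisMap_tmul (u : U.carrier) (g h : H) :
    (U.tensor R.permModule).orbit (R.galoisMap U (u ⊗ₜ[k] g)) h =
      R.galoisMap U (u ⊗ₜ[k] (g * h)) := by
  rw [galoisMap_tmul, galoisMap_tmul]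
  exact ((U.tensor R.permModule).orbit_mul _ g h).symm

lemma rTensor_galoisMap_tmul {U W : RightModule k H} {f : U.carrier →ₗ[k] W.carrier}
    (hf : Intertwines U.act W.act f) (u : U.carrier) (h : H) :
    f.rTensor R.permModule.carrier (R.galoisMap U (u ⊗ₜ[k] h)) =
      R.galoisMap W (f u ⊗ₜ[k] h) := by
  have rTensor_orbit := RightModule.intertwines_iff.1
    (RightModule.intertwines_rTensor hf R.permModule)
  rw [galoisMap_tmul, galoisMap_tmul]
  exact LinearMap.congr_fun (LinearMap.congr_fun rTensor_orbit (u ⊗ₜ[k] R.proj 1)) h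

lemma orbit_tmul_proj_one_coe (u : U.carrier) (r : R.toSubalgebra) :
    (U.tensor R.permModule).orbit (u ⊗ₜ[k] R.proj 1) r = U.orbit u r ⊗ₜ[k] R.proj 1 := by
  let incl : R.toSubalgebra →ₗ[k] H := R.toSubalgebra.val.toLinearMap
  have map_comp_comul : (TensorProduct.map (U.orbit u) R.proj ∘ₗ comul) ∘ₗ incl =
      (TensorProduct.mk k _ _).flip (R.proj 1) ∘ₗ U.orbit u ∘ₗ incl :=
    (map_comp_comul_comp _ R.proj R.incl).trans <|
      (congrArg (TensorProduct.map _ · ∘ₗ comul) R.proj_comp_val).trans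
        (map_smulRight_counit_comp_comul _ _)
  rw [orbit_tmul_proj_one]
  exact LinearMap.congr_fun map_comp_comul r

/-- The kernel of `U ⊗ H → U ⊗_R H`. -/
def balanced : Submodule k (U.carrier ⊗[k] H) :=
  .span k {t | ∃ (u : U.carrier) (r : R.toSubalgebra) (h : H),
    t = U.orbit u r ⊗ₜ[k] h - u ⊗ₜ[k] (r * h : H)}

lemma balanced_le_ker_galoisMap : R.balanced U ≤ LinearMap.ker (R.galoisMap U) := by
  refine Submodule.span_le.2 ?_
  rintro _ ⟨u, r, h, rfl⟩
  refine LinearMap.sub_mem_ker_iff.2 ?_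
  rw [galoisMap_tmul, galoisMap_tmul, ← orbit_tmul_proj_one_coe]
  exact ((U.tensor R.permModule).orbit_mul _ _ _).symm

lemma mkQ_balanced_orbit_tmul (u : U.carrier) (r : R.toSubalgebra) (h : H) :
    (R.balanced U).mkQ (U.orbit u r ⊗ₜ[k] h) = (R.balanced U).mkQ (u ⊗ₜ[k] (r * h : H)) :=
  (Submodule.Quotient.eq _).2 (Submodule.subset_span ⟨u, r, h, rfl⟩)

lemma mkQ_balanced_antipode_comul_mul (u : U.carrier) (r : R.toSubalgebra) (t : H ⊗[k] H) :
    (R.balanced U).mkQ ((U.orbit u ∘ₗ antipode k).rTensor H (comul (r : H) * t)) =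
      counit (R := k) r • (R.balanced U).mkQ ((U.orbit u ∘ₗ antipode k).rTensor H t) := by
  let 𝓡 := (ℛ k r).induced R.incl
  have mkQ_orbit_tmul (v : U.carrier) (i) (h : H) :
      (R.balanced U).mkQ (U.orbit v (𝓡.right i) ⊗ₜ[k] h) =
        (R.balanced U).mkQ (v ⊗ₜ[k] (𝓡.right i * h)) :=
    R.mkQ_balanced_orbit_tmul U v ((ℛ k r).right i) h
  induction t with
  | zero => simp only [mul_zero, map_zero, smul_zero]
  | add s t hs ht => simp only [mul_add, map_add, smul_add, hs, ht]
  | tmul g h =>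
    let v := U.orbit u (antipode k g)
    calc
      _ = ∑ i ∈ 𝓡.index, (R.balanced U).mkQ
            (U.orbit v (antipode k (𝓡.left i)) ⊗ₜ[k] (𝓡.right i * h)) := by
        rw [show comul (r : H) = _ from 𝓡.eq.symm]
        simp only [Finset.sum_mul, Algebra.TensorProduct.tmul_mul_tmul, map_sum,
          LinearMap.rTensor_tmul, LinearMap.comp_apply, antipode_mul_antidistrib,
          RightModule.orbit_mul, v]
      _ = (R.balanced U).mkQ
            (U.orbit v (∑ i ∈ 𝓡.index, antipode k (𝓡.left i) * 𝓡.right i) ⊗ₜ[k] h) := by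
        simp only [map_sum, TensorProduct.sum_tmul, ← mkQ_orbit_tmul, RightModule.orbit_mul]
      _ = counit (R := k) r • (R.balanced U).mkQ (v ⊗ₜ[k] h) := by
        rw [sum_antipode_mul_eq_smul, map_smul, RightModule.orbit_one, ← TensorProduct.smul_tmul',
          map_smul]
        rfl

lemma ker_galoisMap : LinearMap.ker (R.galoisMap U) = R.balanced U := by
  refine le_antisymm (fun t ht => ?_) (R.balanced_le_ker_galoisMap U)
  have ker_lTensor_le : LinearMap.ker (R.proj.lTensor U.carrier) ≤
      LinearMap.ker ((R.balanced U).mkQ ∘ₗ shearLeft (U.orbit.compl₂ (antipode k))) := by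
    rw [ker_lTensor_eq_span R.proj_surjective R.ker_proj, Submodule.span_le]
    rintro _ ⟨u, -, _, ⟨r, hr, h, rfl⟩, rfl⟩
    have mkQ_shearLeft : (R.balanced U).mkQ (shearLeft (U.orbit.compl₂ (antipode k))
        (u ⊗ₜ[k] (r * h : H))) = 0 := by
      rw [shearLeft_tmul, Bialgebra.comul_mul]
      exact (R.mkQ_balanced_antipode_comul_mul U u r (comul h)).trans
        ((congrArg (· • _) hr).trans (zero_smul k _))
    exact mkQ_shearLeft
  have shear_inverse : shearLeft (U.orbit.compl₂ (antipode k)) (shearLeft U.orbit t) = t :=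
    LinearMap.congr_fun U.shearLeft_orbit_antipode_comp_shearLeft_orbit t
  exact (Submodule.Quotient.mk_eq_zero _).1 <|
    (congrArg (R.balanced U).mkQ shear_inverse.symm).trans (ker_lTensor_le ht)

/-- The Galois isomorphism `M ⊗_R H ≅ M ⊗ V`. -/
def galoisIso (M : Bimodule k X H) : Bimodule.Iso
    ((M.restrict (.id k X) R.toSubalgebra.val).tensor
      ((Bimodule.regular k H).restrict R.toSubalgebra.val (.id k H)))
    (M.twist R.permModule) where
  equiv := (Submodule.quotEquivOfEq _ _ (R.ker_galoisMap M.toRight).symm).trans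
    ((R.galoisMap M.toRight).quotKerEquivOfSurjective (R.galoisMap_surjective M.toRight))
  left x := Submodule.linearMap_qext _ <| TensorProduct.ext' fun m (h : H) =>
    (R.rTensor_galoisMap_tmul (U := M.toRight) (W := M.toRight) (M.comm x) m h).symm
  right y := Submodule.linearMap_qext _ <| TensorProduct.ext' fun m (h : H) =>
    (R.orbit_galoisMap_tmul M.toRight m h y.unop).symm

/-- The Galois isomorphisms turn the tensor powers of `H` over `R` into twists of the regular
bimodule by the tensor powers of `V`. -/
def tensorPowerIso : (n : ℕ) → Bimodule.Iso (tensorPower R.toSubalgebra n)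
    ((Bimodule.regular k H).twist (R.permModule.tpow n))
  | 0 => Bimodule.twistUnit _
  | n + 1 => (R.galoisIso _).trans <|
      ((tensorPowerIso n).twist R.permModule).trans (Bimodule.twistTwist _ _ _)

end HopfSubalgebra

/-! ### Right coinvariants -/

section AntipodeInv

open Coalgebra HopfAlgebra
open scoped Coalgebra

variable {k H : Type*} [CommRing k] [Ring H] [HopfAlgebra k H]

/-- The inverse of a bijective antipode. -/
def antipodeInv (hS : Function.Bijective (antipode k (A := H))) : H →ₗ[k] H :=
  (LinearEquiv.ofBijective (antipode k) hS).symm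

variable (hS : Function.Bijective (antipode k (A := H)))

lemma antipode_antipodeInv (x : H) : antipode k (antipodeInv hS x) = x :=
  (LinearEquiv.ofBijective (antipode k) hS).apply_symm_apply x

lemma antipodeInv_antipode (x : H) : antipodeInv hS (antipode k x) = x :=
  (LinearEquiv.ofBijective (antipode k) hS).symm_apply_apply x

lemma antipodeInv_mul (x y : H) :
    antipodeInv hS (x * y) = antipodeInv hS y * antipodeInv hS x :=
  hS.injective <| by simp only [antipode_antipodeInv, antipode_mul_antidistrib]

lemma sum_antipodeInv_mul {ι : Type*} {x : H} (𝓡 : Repr k x ι) :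
    ∑ i ∈ 𝓡.index, antipodeInv hS (𝓡.right i) * 𝓡.left i = algebraMap k H (counit x) :=
  hS.injective <| by
    simp only [map_sum, antipode_mul_antidistrib, antipode_antipodeInv,
      sum_antipode_mul_eq_algebraMap_counit, Algebra.algebraMap_eq_smul_one, map_smul, antipode_one]

lemma sum_mul_antipodeInv {ι : Type*} {x : H} (𝓡 : Repr k x ι) :
    ∑ i ∈ 𝓡.index, 𝓡.right i * antipodeInv hS (𝓡.left i) = algebraMap k H (counit x) :=
  hS.injective <| by
    simp only [map_sum, antipode_mul_antidistrib, antipode_antipodeInv,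
      sum_mul_antipode_eq_algebraMap_counit, Algebra.algebraMap_eq_smul_one, map_smul, antipode_one]

end AntipodeInv

namespace RightModule

open Coalgebra HopfAlgebra
open scoped Coalgebra

variable {k : Type u} [Field k] {H : Type u} [Ring H] [HopfAlgebra k H] (U : RightModule k H)

lemma shearRight_orbit_surjective (hS : Function.Bijective (antipode k (A := H))) :
    Function.Surjective (shearRight U.orbit) := by
  refine Function.RightInverse.surjective (g := shearRight (U.orbit.compl₂ (antipodeInv hS))) <|
    LinearMap.congr_fun (shearRight_comp_shearRight fun u => LinearMap.ext fun h => ?_)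
  calc TensorProduct.lift U.orbit.flip ((U.orbit u ∘ₗ antipodeInv hS).lTensor H (comul h))
      = U.orbit u (∑ i ∈ (ℛ k h).index, antipodeInv hS ((ℛ k h).right i) * (ℛ k h).left i) := by
        nth_rw 1 [← (ℛ k h).eq]
        simp only [map_sum, LinearMap.lTensor_tmul, LinearMap.comp_apply, TensorProduct.lift.tmul,
          LinearMap.flip_apply, orbit_mul]
    _ = counit (R := k) h • u := by
        rw [sum_antipodeInv_mul, Algebra.algebraMap_eq_smul_one, map_smul, orbit_one]

variable (hS : Function.Bijective (antipode k (A := H)))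

/-- The map `H ⊗ U → U`, `h ⊗ u ↦ u S⁻¹(h)`, which identifies `U` with the right coinvariants
of `H ⊗ U`. -/
def actAntipodeInv : H ⊗[k] U.carrier →ₗ[k] U.carrier :=
  TensorProduct.lift (U.orbit.compl₂ (antipodeInv hS)).flip

lemma actAntipodeInv_tmul (h : H) (u : U.carrier) :
    U.actAntipodeInv hS (h ⊗ₜ[k] u) = U.orbit u (antipodeInv hS h) := rfl

lemma actAntipodeInv_surjective : Function.Surjective (U.actAntipodeInv hS) := fun u =>
  ⟨antipode k (1 : H) ⊗ₜ[k] u, by rw [actAntipodeInv_tmul, antipodeInv_antipode, orbit_one]⟩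

lemma actAntipodeInv_shearRight (h : H) (u : U.carrier) :
    U.actAntipodeInv hS (shearRight U.orbit (h ⊗ₜ[k] u)) = counit (R := k) h • u := by
  calc U.actAntipodeInv hS (shearRight U.orbit (h ⊗ₜ[k] u))
      = U.orbit u (∑ i ∈ (ℛ k h).index, (ℛ k h).right i * antipodeInv hS ((ℛ k h).left i)) := by
        rw [shearRight_tmul, ← (ℛ k h).eq]
        simp only [map_sum, LinearMap.lTensor_tmul, actAntipodeInv_tmul, orbit_mul]
    _ = counit (R := k) h • u := by
        rw [sum_mul_antipodeInv, Algebra.algebraMap_eq_smul_one, map_smul, orbit_one]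

/-- The right module `H ⊗ U`, with the diagonal action. -/
abbrev regularTensor : RightModule k H := (Bimodule.regular k H).toRight.tensor U

lemma shearRight_orbit_tmul (h : H) (u : U.carrier) :
    shearRight U.orbit (h ⊗ₜ[k] u) = U.regularTensor.orbit ((1 : H) ⊗ₜ[k] u) h := by
  have orbit_regular_one : (Bimodule.regular k H).toRight.orbit (1 : H) = .id :=
    LinearMap.ext fun g : H => one_mul g
  exact (shearRight_tmul U.orbit h u).trans (LinearMap.congr_fun ((orbit_tmul _ _).trans
    (congrArg (TensorProduct.map · (U.orbit u) ∘ₗ comul) orbit_regular_one)) h).symm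

lemma actAntipodeInv_orbit (s : U.regularTensor.carrier) (h : H) :
    U.actAntipodeInv hS (U.regularTensor.orbit s h) =
      counit (R := k) h • U.actAntipodeInv hS s := by
  have orbit_shearRight (g : H) (u : U.carrier) :
      U.regularTensor.orbit (shearRight U.orbit (g ⊗ₜ[k] u)) h =
        shearRight U.orbit ((g * h) ⊗ₜ[k] u) := by
    rw [shearRight_orbit_tmul, shearRight_orbit_tmul]
    exact (U.regularTensor.orbit_mul _ g h).symm
  let act : H ⊗[k] U.carrier →ₗ[k] H ⊗[k] U.carrier := U.regularTensor.act (op h)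
  have comp_shearRight : U.actAntipodeInv hS ∘ₗ act ∘ₗ shearRight U.orbit =
      counit (R := k) h • (U.actAntipodeInv hS ∘ₗ shearRight U.orbit) :=
    TensorProduct.ext' fun g u =>
      calc U.actAntipodeInv hS (act (shearRight U.orbit (g ⊗ₜ[k] u)))
          = U.actAntipodeInv hS (shearRight U.orbit ((g * h) ⊗ₜ[k] u)) :=
            congrArg _ (orbit_shearRight g u)
        _ = counit (R := k) h • U.actAntipodeInv hS (shearRight U.orbit (g ⊗ₜ[k] u)) := by
            rw [actAntipodeInv_shearRight, actAntipodeInv_shearRight, Bialgebra.counit_mul,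
              mul_comm, mul_smul]
  obtain ⟨t, rfl⟩ := U.shearRight_orbit_surjective hS s
  exact LinearMap.congr_fun comp_shearRight t

lemma ker_actAntipodeInv : LinearMap.ker (U.actAntipodeInv hS) =
    .span k {t | ∃ h : H, counit (R := k) h = 0 ∧ ∃ s, U.regularTensor.orbit s h = t} := by
  refine le_antisymm ?_ (Submodule.span_le.2 ?_)
  · have comp_shearRight : U.actAntipodeInv hS ∘ₗ shearRight U.orbit =
        (TensorProduct.lid k U.carrier).toLinearMap ∘ₗ counit.rTensor U.carrier :=
      TensorProduct.ext' (U.actAntipodeInv_shearRight hS)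
    have counit_surjective : Function.Surjective (counit (R := k) (A := H)) := fun c =>
      ⟨algebraMap k H c, Bialgebra.counit_algebraMap c⟩
    rw [← Submodule.map_comap_eq_of_surjective (U.shearRight_orbit_surjective hS)
        (LinearMap.ker _), ← LinearMap.ker_comp, comp_shearRight, LinearEquiv.ker_comp,
      ker_rTensor_eq_span counit_surjective (Submodule.span_eq _).symm, Submodule.map_span_le]
    rintro _ ⟨h, hh, u, -, rfl⟩
    exact Submodule.subset_span ⟨h, hh, _, (U.shearRight_orbit_tmul h u).symm⟩
  · rintro _ ⟨h, hh, s, rfl⟩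
    exact (U.actAntipodeInv_orbit hS s h).trans (by rw [hh, zero_smul])

end RightModule

namespace HopfSubalgebra

open Coalgebra HopfAlgebra

variable {k : Type u} [Field k] {H : Type u} [Ring H] [HopfAlgebra k H] (R : HopfSubalgebra k H)
  (hS : Function.Bijective (antipode k (A := H))) (U : RightModule k H)

/-- The antipode of `R`. -/
def antipodeRestrict (r : R.toSubalgebra) : R.toSubalgebra :=
  ⟨antipode k (r : H), R.antipode_mem r r.2⟩

lemma actAntipodeInv_antipode_smul (r : R.toSubalgebra) (t : H ⊗[k] U.carrier) :
    U.actAntipodeInv hS ((LinearMap.mulLeft k (antipode k (r : H))).rTensor U.carrier t) =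
      U.orbit (U.actAntipodeInv hS t) r := by
  induction t with
  | zero => simp only [map_zero, LinearMap.zero_apply]
  | add s t hs ht => simp only [map_add, LinearMap.add_apply, hs, ht]
  | tmul h u =>
    rw [LinearMap.rTensor_tmul, LinearMap.mulLeft_apply, RightModule.actAntipodeInv_tmul,
      RightModule.actAntipodeInv_tmul, antipodeInv_mul, antipodeInv_antipode, RightModule.orbit_mul]

lemma isCoinvariants_actAntipodeInv : IsCoinvariants
    (fun r : R.toSubalgebraᵐᵒᵖ => R.antipodeRestrict r.unop ⊗ₜ[k] (1 : Hᵐᵒᵖ))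
    ((fun h : H => (1 : R.toSubalgebra) ⊗ₜ[k] op h) '' {h | counit (R := k) h = 0})
    (show (((Bimodule.regular k H).twist U).restrict R.toSubalgebra.val (.id k H)).carrier →ₗ[k]
      (U.restrict R.toSubalgebra.val).carrier from U.actAntipodeInv hS) where
  surjective := U.actAntipodeInv_surjective hS
  map_smul r t := (congrArg (U.actAntipodeInv hS) (Bimodule.tmul_one_smul _ _ t)).trans
    (R.actAntipodeInv_antipode_smul hS U r.unop t)
  ker_eq := by
    simp only [Set.exists_mem_image, Bimodule.one_tmul_smul]
    exact U.ker_actAntipodeInv hS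

include hS in
lemma similar_restrict_of_similar_regular_twist {U U' : RightModule k H}
    (h : Similar (R.toSubalgebra ⊗[k] Hᵐᵒᵖ)
      (((Bimodule.regular k H).twist U).restrict R.toSubalgebra.val (.id k H)).carrier
      (((Bimodule.regular k H).twist U').restrict R.toSubalgebra.val (.id k H)).carrier) :
    Similar R.toSubalgebraᵐᵒᵖ (U.restrict R.toSubalgebra.val).carrier
      (U'.restrict R.toSubalgebra.val).carrier :=
  (R.isCoinvariants_actAntipodeInv hS U).similar (R.isCoinvariants_actAntipodeInv hS U') h

end HopfSubalgebra

/-! ### Subalgebra depth and module depth -/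

namespace RightModule

variable {k : Type u} [Field k] {H : Type u} [Ring H] [Bialgebra k H]

lemma exists_intertwines_tensor_tpow (W : RightModule k H) (n : ℕ) :
    ∃ e : (W.tensor (W.tpow n)).carrier ≃ₗ[k] (W.tpow (n + 1)).carrier,
      Intertwines (W.tensor (W.tpow n)).act (W.tpow (n + 1)).act e.toLinearMap := by
  induction n with
  | zero =>
    exact ⟨(TensorProduct.rid k W.carrier).trans (TensorProduct.lid k W.carrier).symm,
      (intertwines_lid W).symm.comp (intertwines_rid W)⟩
  | succ n ih =>
    obtain ⟨e, he⟩ := ih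
    exact ⟨(TensorProduct.assoc k W.carrier (W.tpow n).carrier W.carrier).symm.trans
        (TensorProduct.congr e (.refl k W.carrier)),
      (intertwines_rTensor he W).comp (intertwines_assoc W (W.tpow n) W).symm⟩

end RightModule

namespace HopfSubalgebra

open Coalgebra HopfAlgebra

variable {k : Type u} [Field k] {H : Type u} [Ring H] [HopfAlgebra k H] (R : HopfSubalgebra k H)

lemma hasRightDepth_iff (n : ℕ) : HasRightDepth R.toSubalgebra n ↔
    (R.permModule.restrict R.toSubalgebra.val).HasModuleDepth n := by
  rw [hasModuleDepth_restrict_iff]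
  exact (similar_congr
    ((R.tensorPowerIso (n + 1)).restrict (.id k H) R.toSubalgebra.val).toLinearEquiv
    ((R.tensorPowerIso n).restrict (.id k H) R.toSubalgebra.val).toLinearEquiv).trans
    (Bimodule.similar_restrict_regular_twist_iff R.incl _ _)

lemma similar_tensorPower_iff (n : ℕ) : Similar (H ⊗[k] Hᵐᵒᵖ)
    (tensorPower R.toSubalgebra (n + 1)).carrier (tensorPower R.toSubalgebra n).carrier ↔
      R.permModule.HasModuleDepth n := by
  rw [hasModuleDepth_iff]
  exact (similar_congr (R.tensorPowerIso (n + 1)).toLinearEquiv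
    (R.tensorPowerIso n).toLinearEquiv).trans
    (Bimodule.similar_restrict_regular_twist_iff (.id k H) _ _)

lemma hasModuleDepth_of_hasLeftDepth (hS : Function.Bijective (antipode k (A := H))) {n : ℕ}
    (h : HasLeftDepth R.toSubalgebra n) :
    (R.permModule.restrict R.toSubalgebra.val).HasModuleDepth n := by
  rw [hasModuleDepth_restrict_iff]
  exact R.similar_restrict_of_similar_regular_twist hS <|
    (similar_congr
      ((R.tensorPowerIso (n + 1)).restrict R.toSubalgebra.val (.id k H)).toLinearEquiv
      ((R.tensorPowerIso n).restrict R.toSubalgebra.val (.id k H)).toLinearEquiv).1 h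

lemma exists_isLeftCoinvariants_tensorPowerBB (n : ℕ) :
    ∃ π, Bimodule.IsLeftCoinvariants {r : R.toSubalgebra | counit (R := k) r = 0}
      (tensorPowerBB R.toSubalgebra n) ((R.permModule.tpow n).restrict R.toSubalgebra.val) π := by
  cases n with
  | zero =>
    have restrict_unit : (R.permModule.tpow 0).restrict R.toSubalgebra.val = .unit k _ :=
      RightModule.restrict_unit R.incl
    rw [restrict_unit]
    exact ⟨_, Bimodule.isLeftCoinvariants_counit k R.toSubalgebra⟩
  | succ n =>
    obtain ⟨e, he⟩ := R.permModule.exists_intertwines_tensor_tpow n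
    exact ⟨_, Bimodule.IsLeftCoinvariants.of_iso
      (((R.isLeftCoinvariants_proj.twist _).congr e he).restrict R.toSubalgebra.val)
      ((R.tensorPowerIso n).restrict R.toSubalgebra.val R.toSubalgebra.val)⟩

lemma hasModuleDepth_of_hasOddDepth {n : ℕ} (h : HasOddDepth R.toSubalgebra n) :
    (R.permModule.restrict R.toSubalgebra.val).HasModuleDepth n := by
  obtain ⟨π, hπ⟩ := R.exists_isLeftCoinvariants_tensorPowerBB n
  obtain ⟨π', hπ'⟩ := R.exists_isLeftCoinvariants_tensorPowerBB (n + 1)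
  exact (R.hasModuleDepth_restrict_iff n).2 (hπ'.similar hπ h)

end HopfSubalgebra

lemma minEvenDepth_eq_of_bounds {k : Type u} [Field k] {A : Type u} [Ring A] [Algebra k A]
    {B : Subalgebra k A} {d : ℕ∞} (lower : 2 * d + 1 ≤ minDepth B)
    (upper : minDepth B ≤ 2 * d + 2) : minEvenDepth B = 2 * d + 2 := by
  refine le_antisymm (sInf_le ⟨⟨d + 1, by ring⟩, upper⟩) (le_sInf ?_)
  rintro _ ⟨⟨m, rfl⟩, hm⟩
  have odd_le_even : 2 * d + 1 ≤ m + m := lower.trans hm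
  cases m using ENat.recTopCoe with
  | top => simp only [top_add, le_top]
  | coe m =>
    cases d using ENat.recTopCoe with
    | top => simp [← Nat.cast_add] at odd_le_even
    | coe d => norm_cast at odd_le_even ⊢; lia

lemma two_mul_iInf_add {p : ℕ → Prop} (a : ℕ∞) :
    2 * (⨅ (n : ℕ) (_ : p n), (n : ℕ∞)) + a = ⨅ (n : ℕ) (_ : p n), (2 * (n : ℕ∞) + a) := by
  simp only [ENat.mul_iInf_of_ne two_ne_zero, ENat.iInf₂_add]

namespace HopfSubalgebra

open HopfAlgebra

variable {k : Type u} [Field k] {H : Type u} [Ring H] [HopfAlgebra k H] (R : HopfSubalgebra k H)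

lemma exists_hasModuleDepth_of_hasDepth (hS : Function.Bijective (antipode k (A := H))) {d : ℕ}
    (h : HasDepth R.toSubalgebra d) :
    ∃ n, 2 * n + 1 ≤ d ∧ (R.permModule.restrict R.toSubalgebra.val).HasModuleDepth n := by
  rcases h with ⟨n, rfl, h⟩ | ⟨n, rfl, h | h⟩
  · exact ⟨n, le_rfl, R.hasModuleDepth_of_hasOddDepth h⟩
  · exact ⟨n, by lia, R.hasModuleDepth_of_hasLeftDepth hS h⟩
  · exact ⟨n, by lia, (R.hasRightDepth_iff n).1 h⟩

lemma two_mul_depth_add_one_le_minDepth (hS : Function.Bijective (antipode k (A := H))) :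
    2 * (R.permModule.restrict R.toSubalgebra.val).depth + 1 ≤ minDepth R.toSubalgebra := by
  refine le_iInf₂ fun d h => ?_
  obtain ⟨n, hnd, hn⟩ := R.exists_hasModuleDepth_of_hasDepth hS h
  calc 2 * (R.permModule.restrict R.toSubalgebra.val).depth + 1
      ≤ 2 * (n : ℕ∞) + 1 := by gcongr; exact iInf₂_le n hn
    _ ≤ d := by exact_mod_cast hnd

lemma minDepth_le_two_mul_depth_add_two :
    minDepth R.toSubalgebra ≤ 2 * (R.permModule.restrict R.toSubalgebra.val).depth + 2 := by
  rw [RightModule.depth, two_mul_iInf_add]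
  refine le_iInf₂ fun n h => ?_
  calc minDepth R.toSubalgebra
      ≤ (2 * (n + 1) : ℕ) :=
        iInf₂_le _ (.inr ⟨n, rfl, .inr ((R.hasRightDepth_iff n).2 h)⟩)
    _ = 2 * (n : ℕ∞) + 2 := by push_cast; ring

lemma minHDepth_eq : minHDepth R.toSubalgebra = 2 * R.permModule.depth + 1 := by
  rw [RightModule.depth, two_mul_iInf_add]
  refine le_antisymm (le_iInf₂ fun n h => ?_) (le_iInf₂ ?_)
  · exact iInf₂_le (2 * n + 1) ⟨n, rfl, (R.similar_tensorPower_iff n).2 h⟩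
  · rintro _ ⟨n, rfl, h⟩
    exact iInf₂_le n ((R.similar_tensorPower_iff n).1 h)

end HopfSubalgebra

/-! ### Bijectivity of the antipode -/

section Antipode

open HopfAlgebra WithConv
open scoped Coalgebra

section Convolution

variable {R H A : Type*} [CommRing R] [Ring H] [HopfAlgebra R H] [Ring A] [Algebra R A]

lemma toConv_comp_antipode_mul (p : H →ₐ[R] A) :
    toConv (p.toLinearMap ∘ₗ antipode R) * toConv p.toLinearMap = 1 := by
  ext x
  rw [(ℛ R x).convMul_apply]
  simpa using congr(p $(sum_antipode_mul_eq_algebraMap_counit (ℛ R x)))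

lemma toConv_mul_comp_antipode (p : H →ₐ[R] A) :
    toConv p.toLinearMap * toConv (p.toLinearMap ∘ₗ antipode R) = 1 := by
  ext x
  rw [(ℛ R x).convMul_apply]
  simpa using congr(p $(sum_mul_antipode_eq_algebraMap_counit (ℛ R x)))

lemma algHom_eq_of_comp_antipode_eq {p q : H →ₐ[R] A}
    (h : p.toLinearMap ∘ₗ antipode R = q.toLinearMap ∘ₗ antipode R) : p = q :=
  AlgHom.toLinearMap_injective <| toConv_injective <|
    left_inv_eq_right_inv (toConv_mul_comp_antipode p) (h ▸ toConv_comp_antipode_mul q)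

variable (R H) in
/-- The square `S²` of the antipode as an algebra endomorphism. -/
def antipodeSq : H →ₐ[R] H :=
  (AlgHom.opComm (antipodeAlgHomOp R H)).comp (antipodeAlgHomOp R H)

lemma antipodeSq_apply (x : H) : antipodeSq R H x = antipode R (antipode R x) := rfl

lemma algHom_eq_of_comp_antipodeSq_eq {p q : H →ₐ[R] A}
    (h : p.comp (antipodeSq R H) = q.comp (antipodeSq R H)) : p = q := by
  have hop : (AlgHom.op p).comp (antipodeAlgHomOp R H) =
      (AlgHom.op q).comp (antipodeAlgHomOp R H) :=
    algHom_eq_of_comp_antipode_eq <| LinearMap.ext fun x => congrArg op (DFunLike.congr_fun h x)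
  exact algHom_eq_of_comp_antipode_eq <|
    LinearMap.ext fun x => op_injective (DFunLike.congr_fun hop x)

lemma algHom_eq_of_comp_antipodeSq_pow_eq {p q : H →ₐ[R] A} (n : ℕ)
    (h : p.comp (antipodeSq R H ^ n) = q.comp (antipodeSq R H ^ n)) : p = q := by
  induction n with
  | zero => exact h
  | succ n ih => exact ih (algHom_eq_of_comp_antipodeSq_eq h)

end Convolution

lemma exists_algHom_comp_eq_of_isCompl {R A : Type*} [CommRing R] [Ring A] [Algebra R A]
    (F : A →ₐ[R] A)
    (hF : IsCompl (LinearMap.range F.toLinearMap) (LinearMap.ker F.toLinearMap)) :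
    ∃ π : A →ₐ[R] A, π.comp F = F ∧ ∀ x, F x = 0 → π x = 0 := by
  let π := (LinearMap.range F.toLinearMap).projection _ hF
  have apply_π (x : A) : F (π x) = F x := by
    have : F (x - π x) = 0 := Submodule.sub_projection_mem hF x
    rw [map_sub, sub_eq_zero] at this
    exact this.symm
  have inj_on_range {x y : A} (hx : x ∈ F.range) (hy : y ∈ F.range) (h : F x = F y) : x = y :=
    sub_eq_zero.1 <| Submodule.disjoint_def.1 hF.disjoint _ (F.range.sub_mem hx hy) (by simp [h])
  have π_mem (x : A) : π x ∈ F.range := Submodule.projection_apply_mem hF x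
  refine ⟨AlgHom.ofLinearMap π ?_ fun x y => ?_, AlgHom.ext fun x => ?_, fun x hx => ?_⟩
  · exact inj_on_range (π_mem 1) F.range.one_mem (apply_π 1)
  · exact inj_on_range (π_mem _) (F.range.mul_mem (π_mem x) (π_mem y)) (by simp [apply_π])
  · exact Submodule.projection_apply_of_mem_left hF ⟨x, rfl⟩
  · exact (Submodule.projection_apply_eq_zero_iff hF).2 hx

/-- A power `F` of `S²` splits `H` into its range and its kernel, and the projection `π` onto the
range satisfies `π ∘ F = F`. As `S²` is an epimorphism of algebras, this forces `π = id`. -/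
theorem antipode_bijective (k H : Type*) [Field k] [Ring H] [HopfAlgebra k H]
    [FiniteDimensional k H] : Function.Bijective (antipode k (A := H)) := by
  suffices Function.Injective (antipode k (A := H)) from
    ⟨this, LinearMap.surjective_of_injective this⟩
  obtain ⟨N, hF, hN⟩ := ((antipodeSq k H).toLinearMap.eventually_isCompl_ker_pow_range_pow.and
    (Filter.eventually_ne_atTop 0)).exists
  rw [← AlgHom.toEnd_apply, ← map_pow] at hF
  obtain ⟨π, hπ, ker_le⟩ := exists_algHom_comp_eq_of_isCompl (antipodeSq k H ^ N) hF.symm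
  have π_eq_id : π = AlgHom.id k H := algHom_eq_of_comp_antipodeSq_pow_eq N hπ
  refine (injective_iff_map_eq_zero _).2 fun x hx => ?_
  have antipodeSq_pow_apply : (antipodeSq k H ^ N) x = 0 := by
    obtain ⟨n, rfl⟩ := Nat.exists_eq_succ_of_ne_zero hN
    rw [pow_succ, AlgHom.mul_apply, antipodeSq_apply, hx, map_zero, map_zero]
  simpa [π_eq_id] using ker_le x antipodeSq_pow_apply

end Antipode

end HopfDepth

end

theorem mainTheorem1_general {k : Type u} [Field k] {H : Type u} [Ring H] [HopfAlgebra k H]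
    (hS : Function.Bijective (HopfAlgebra.antipode k (A := H))) (R : HopfDepth.HopfSubalgebra k H) :
    HopfDepth.minEvenDepth R.toSubalgebra =
        2 * (R.permModule.restrict R.toSubalgebra.val).depth + 2 ∧
      HopfDepth.minHDepth R.toSubalgebra = 2 * R.permModule.depth + 1 ∧
      2 * (R.permModule.restrict R.toSubalgebra.val).depth + 1 ≤
        HopfDepth.minDepth R.toSubalgebra ∧
      HopfDepth.minDepth R.toSubalgebra ≤
        2 * (R.permModule.restrict R.toSubalgebra.val).depth + 2 := by
  have lower := R.two_mul_depth_add_one_le_minDepth hS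
  have upper := R.minDepth_le_two_mul_depth_add_two
  exact ⟨HopfDepth.minEvenDepth_eq_of_bounds lower upper, R.minHDepth_eq, lower, upper⟩

theorem mainTheorem1 {k : Type u} [Field k] {H : Type u} [Ring H] [HopfAlgebra k H]
    [FiniteDimensional k H] (R : HopfDepth.HopfSubalgebra k H) :
    HopfDepth.minEvenDepth R.toSubalgebra =
        2 * (R.permModule.restrict R.toSubalgebra.val).depth + 2 ∧
      HopfDepth.minHDepth R.toSubalgebra = 2 * R.permModule.depth + 1 ∧
      2 * (R.permModule.restrict R.toSubalgebra.val).depth + 1 ≤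
        HopfDepth.minDepth R.toSubalgebra ∧
      HopfDepth.minDepth R.toSubalgebra ≤
        2 * (R.permModule.restrict R.toSubalgebra.val).depth + 2 :=
  mainTheorem1_general (HopfDepth.antipode_bijective k H) R
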